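/- Let $U,\kappa:\mathbb R\to\mathbb R$ and consider one oscillator coupled to two identical thermostats, $$\ddot q=-U'(q)+\int_{-\infty}^{\infty}\kappa\,\xi_1\,d\nu+\int_{-\infty}^{\infty}\kappa\,\xi_2\,d\nu,\qquad \ddot\xi_m(\nu,t)=-\nu^2\xi_m(\nu,t)+\kappa(\nu)q(t),\quad m=1,2,\ \nu,t\in\mathbb R .$$ Assume: (A1) $U$ is $C^\infty$-smooth. (A2) $\kappa$ is $C^2$, $\kappa(\nu)=0$ if and only if $\nu=0$, $\kappa,\kappa''\in L^1(\mathbb R)\cap L^2(\mathbb R)$, and for some integer $r\ge 0$ both $\nu^r\kappa$ and $|\nu|^{r/2}\kappa'$ are in $L^2(\mathbb R)$. (A3) The effective potential $V^{\rm eff}(q)=U(q)-Kq^2$, where $K=\int_{-\infty}^{\infty}\kappa(\nu)^2\nu^{-2}\,d\nu<\infty$, satisfies $V^{\rm eff}(q)\to+\infty$ as $|q|\to\infty$. (A4) The initial energies are finite: $\int_{-\infty}^{\infty}\dot\xi_m(\nu,0)^2+\nu^2\xi_m(\nu,0)^2\,d\nu<\infty$ for $m=1,2$. (A6) Every critical point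 of $V^{\rm eff}$ is isolated. Then, for every solution $(q,\xi_1,\xi_2)$ defined for all $t\in\mathbb R$, the energies of the thermostats $$\mathcal E_m(t)=\frac12\int_{-\infty}^{\infty}\dot\xi_m(\nu,t)^2+\nu^2\xi_m(\nu,t)^2\,d\nu,\qquad m=1,2,$$ are finite for all $t$, and each of $\mathcal E_1(t)$ and $\mathcal E_2(t)$ converges to a finite limit as $t\to+\infty$ and to a finite limit as $t\to-\infty$. (The limits at $+\infty$ and at $-\infty$, and for $m=1$ and $m=2$, may be different.) -/

import Mathlib

open Filter Topology MeasureTheory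
open scoped ContDiff

namespace TwoThermostats

/-- Regularity, non-vanishing and decay of the coupling function of a thermostat:
`κ` is `C²`, vanishes exactly at `0`, `κ, κ'' ∈ L¹ ∩ L²`, and for some integer `r ≥ 0`
both `ν ^ r κ` and `|ν| ^ (r / 2) κ'` are in `L²`. -/
structure IsCoupling (κ : ℝ → ℝ) : Prop where
  contDiff : ContDiff ℝ 2 κ
  eq_zero_iff : ∀ ν : ℝ, κ ν = 0 ↔ ν = 0
  memLp_one : MemLp κ 1 volume
  memLp_two : MemLp κ 2 volume
  memLp_one_deriv_two : MemLp (iteratedDeriv 2 κ) 1 volume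
  memLp_two_deriv_two : MemLp (iteratedDeriv 2 κ) 2 volume
  decay : ∃ r : ℕ, MemLp (fun ν : ℝ => ν ^ r * κ ν) 2 volume ∧
    MemLp (fun ν : ℝ => |ν| ^ ((r : ℝ) / 2) * deriv κ ν) 2 volume

/-- The constant `K = ∫ κ(ν)² / ν² dν`. -/
noncomputable def couplingConst (κ : ℝ → ℝ) : ℝ :=
  ∫ ν : ℝ, κ ν ^ 2 / ν ^ 2

/-- The effective potential of one oscillator coupled to two identical thermostats,
`U(q) - ∑ₘ K q² / 2`, the sum being over the two thermostats. -/
noncomputable def effPotential (U κ : ℝ → ℝ) (q : ℝ) : ℝ :=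
  U q - ∑ _m : Fin 2, couplingConst κ * q ^ 2 / 2

/-- Every critical point of `V` is isolated among the critical points of `V`. -/
def HasIsolatedCriticalPoints (V : ℝ → ℝ) : Prop :=
  ∀ q : ℝ, deriv V q = 0 → ∀ᶠ x in 𝓝[≠] q, deriv V x ≠ 0

/-- The state (positions `x`, velocities `y`, as functions of the frequency `ν`) of a thermostat
has finite energy: `y` and `ν x` are square integrable. -/
def FiniteEnergy (x y : ℝ → ℝ) : Prop :=
  MemLp y 2 volume ∧ MemLp (fun ν : ℝ => ν * x ν) 2 volume

/-- The energy `½ ∫ y² + ν² x² dν` of a thermostat in the state `(x, y)`. -/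
noncomputable def thermostatEnergy (x y : ℝ → ℝ) : ℝ :=
  (1 / 2) * ∫ ν : ℝ, (y ν ^ 2 + ν ^ 2 * x ν ^ 2)

/-- `q, v : ℝ → ℝ` are the position and velocity of the oscillator as functions of the time `t`,
and `ξ m ν t`, `ξ' m ν t` are the position and velocity at time `t` of the oscillator with internal
frequency `ν` in the `m`-th thermostat. They form a solution, on the whole time line, of
`q'' = -U'(q) + ∑ₘ ∫ κ ξₘ dν`,  `ξₘ''(ν) = -ν² ξₘ(ν) + κ(ν) q`. -/
structure IsSolution (U κ : ℝ → ℝ) (q v : ℝ → ℝ) (ξ ξ' : Fin 2 → ℝ → ℝ → ℝ) : Prop where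
  integrable : ∀ (m : Fin 2) (t : ℝ), Integrable (fun ν : ℝ => κ ν * ξ m ν t) volume
  hasDerivAt_q : ∀ t : ℝ, HasDerivAt q (v t) t
  hasDerivAt_v : ∀ t : ℝ,
    HasDerivAt v (-deriv U (q t) + ∑ m : Fin 2, ∫ ν : ℝ, κ ν * ξ m ν t) t
  hasDerivAt_ξ : ∀ m : Fin 2, ∀ᵐ ν : ℝ, ∀ t : ℝ, HasDerivAt (ξ m ν) (ξ' m ν t) t
  hasDerivAt_ξ' : ∀ m : Fin 2, ∀ᵐ ν : ℝ, ∀ t : ℝ,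
    HasDerivAt (ξ' m ν) (-ν ^ 2 * ξ m ν t + κ ν * q t) t

end TwoThermostats

/-! Write `a = ξ' + iνξ` for the complex amplitude of a thermostat, so that its energy is half its
squared `L²` norm and `a' = iνa + κq`. Duhamel's formula (`IsThermostat.amp_eq`) gives `e^{-iνt}
a(t) = a(0) + κ ∫₀ᵗ e^{-iνs} q(s) ds`. Conservation of energy, after completing the square around
the equilibrium `κq/ν²`, bounds `q`, `v` and the `L²` norms of the amplitudes, because the effective
potential is coercive.

The bound forces `q` to lose all nonzero frequencies. Paired with `φ/κ`, for `φ` a test function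
supported away from `0`, the amplitude `e^{-iνt} a(t)` gives a constant plus `∫₀ᵗ q φ̂`, which
converges since `q` is bounded and `φ̂` is integrable. As `κ` vanishes only at `0`, the functions
`φ/κ` are total, so a weak limit exists (`exists_weak_limit_amp`). Testing it with `e^{iνt} φ/κ` and
applying the Riemann-Lebesgue lemma shows that the convolutions of `q` with `φ̂` vanish at infinity
(`tendsto_convolution_zero`). By the Tauberian lemma `tendsto_shift_sub`, `q(t + a) - q(t) → 0` for
each `a`, and hence `v → 0`, as `v` is Lipschitz.

The shifted amplitude is driven by `v` instead of `q`, so it tends weakly to `0` and the residual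
force does too. The equation `v' = -V'(q) + r`, with `V` the effective potential and `r` this
residual force, now gives `V'(q) → 0`, and isolated critical points make `q` converge. Energy
conservation then yields convergence of the sum of the two energies. For the difference, both
thermostats carry the same forced term, whose square cancels; what remains is linear in it and
converges by weak convergence (`exists_tendsto_energy_sub`). Time reversal handles `t → -∞`. -/

namespace TwoThermostats

open scoped FourierTransform

/-! ### Phases and the Fourier transform in angular frequency -/

/-- The unimodular number `exp (i x)`. -/
noncomputable def phase (x : ℝ) : ℂ := Complex.exp (x * Complex.I)

@[simp] lemma norm_phase (x : ℝ) : ‖phase x‖ = 1 := Complex.norm_exp_ofReal_mul_I x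

@[simp] lemma phase_zero : phase 0 = 1 := by simp [phase]

lemma phase_add (x y : ℝ) : phase (x + y) = phase x * phase y := by
  simp [phase, add_mul, Complex.exp_add]

lemma continuous_phase : Continuous phase := by
  unfold phase; fun_prop

lemma phase_neg_mul_phase (x : ℝ) : phase (-x) * phase x = 1 := by
  rw [← phase_add]; simp

lemma hasDerivAt_phase_mul (a t : ℝ) :
    HasDerivAt (fun t : ℝ => phase (a * t)) (Complex.I * a * phase (a * t)) t := by
  have h : HasDerivAt (fun t : ℝ => ((a * t : ℝ) : ℂ) * Complex.I) ((a : ℂ) * Complex.I) t := by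
    have h1 : HasDerivAt (fun t : ℝ => a * t) a t := by
      simpa using (hasDerivAt_id t).const_mul a
    exact h1.ofReal_comp.mul_const _
  have h2 := h.cexp
  rw [show Complex.I * a * phase (a * t)
    = Complex.exp (((a * t : ℝ) : ℂ) * Complex.I) * (a * Complex.I) by unfold phase; ring]
  exact h2

/-- `∫ exp (-i ν s) φ(ν) dν`. -/
noncomputable def angFourier (φ : ℝ → ℂ) (s : ℝ) : ℂ := ∫ ν : ℝ, phase (-(ν * s)) * φ ν

lemma angFourier_eq_fourier (φ : ℝ → ℂ) (s : ℝ) :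
    angFourier φ s = 𝓕 φ (s / (2 * Real.pi)) := by
  rw [Real.fourier_eq', angFourier]
  congr 1; ext ν
  rw [phase, smul_eq_mul]
  congr 2
  simp only [RCLike.inner_apply, conj_trivial]
  have : -2 * Real.pi * (s / (2 * Real.pi) * ν) = -(ν * s) := by
    field_simp
  rw [this]

/-- Riemann-Lebesgue lemma. -/
lemma tendsto_angFourier_cocompact (φ : ℝ → ℂ) :
    Tendsto (angFourier φ) (cocompact ℝ) (𝓝 0) := by
  have h : angFourier φ = 𝓕 φ ∘ fun s => s * (2 * Real.pi)⁻¹ := by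
    ext s; simp [angFourier_eq_fourier, div_eq_mul_inv]
  rw [h]
  refine (Real.zero_at_infty_fourier φ).comp ?_
  exact (Homeomorph.mulRight₀ _ (inv_ne_zero Real.two_pi_pos.ne')).isClosedEmbedding.tendsto_cocompact

/-- A continuous function dominated by `1 / (1 + s²)`. -/
structure HasQuadraticDecay (k : ℝ → ℂ) : Prop where
  continuous : Continuous k
  bound : ∃ C : ℝ, 0 ≤ C ∧ ∀ s, ‖k s‖ ≤ C * (1 + s ^ 2)⁻¹

lemma HasQuadraticDecay.integrable {k : ℝ → ℂ} (h : HasQuadraticDecay k) : Integrable k := by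
  obtain ⟨C, _, hC⟩ := h.bound
  exact (integrable_inv_one_add_sq.const_mul C).mono' h.continuous.aestronglyMeasurable
    (ae_of_all _ hC)

/-- The transform is a rescaled Schwartz function; its seminorms of weights `0` and `2` suffice. -/
lemma hasQuadraticDecay_angFourier {φ : ℝ → ℂ} (hφ : ContDiff ℝ ∞ φ) (hc : HasCompactSupport φ) :
    HasQuadraticDecay (angFourier φ) := by
  set f : SchwartzMap ℝ ℂ := hc.toSchwartzMap hφ with hf
  have hff : (f : ℝ → ℂ) = φ := rfl
  set g : SchwartzMap ℝ ℂ := 𝓕 f with hg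
  have hgg : ∀ s, angFourier φ s = g (s / (2 * Real.pi)) := by
    intro s; rw [angFourier_eq_fourier, hg, SchwartzMap.fourier_coe, hff]
  refine ⟨?_, ?_⟩
  · have : angFourier φ = fun s => g (s / (2 * Real.pi)) := funext hgg
    rw [this]
    exact g.continuous.comp (by fun_prop)
  · obtain ⟨C0, hC0, h0⟩ := g.decay 0 0
    obtain ⟨C2, hC2, h2⟩ := g.decay 2 0
    refine ⟨C0 + (2 * Real.pi) ^ 2 * C2, by positivity, fun s => ?_⟩
    rw [hgg, ← div_eq_mul_inv, le_div_iff₀ (by positivity)]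
    have e0 := h0 (s / (2 * Real.pi))
    have e2 := h2 (s / (2 * Real.pi))
    simp only [norm_iteratedFDeriv_zero, pow_zero, one_mul, Real.norm_eq_abs, sq_abs] at e0 e2
    have : s ^ 2 = (2 * Real.pi) ^ 2 * (s / (2 * Real.pi)) ^ 2 := by
      field_simp
    calc ‖g (s / (2 * Real.pi))‖ * (1 + s ^ 2)
        = ‖g (s / (2 * Real.pi))‖ +
          (2 * Real.pi) ^ 2 * ((s / (2 * Real.pi)) ^ 2 * ‖g (s / (2 * Real.pi))‖) := by
          rw [this]; ring
      _ ≤ _ := by gcongr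

/-- Fourier inversion at the origin; the factor `2π` comes from using angular frequency. -/
lemma integral_angFourier {φ : ℝ → ℂ} (hφ : ContDiff ℝ ∞ φ) (hc : HasCompactSupport φ) :
    ∫ s, angFourier φ s = 2 * Real.pi * φ 0 := by
  set f : SchwartzMap ℝ ℂ := hc.toSchwartzMap hφ with hf
  have hff : (f : ℝ → ℂ) = φ := rfl
  have h1 : (𝓕⁻ (𝓕 f) : SchwartzMap ℝ ℂ) = f := FourierPair.fourierInv_fourier_eq f
  have h2 : (𝓕⁻ (𝓕 f) : SchwartzMap ℝ ℂ) 0 = φ 0 := by rw [h1, hff]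
  rw [SchwartzMap.fourierInv_coe, SchwartzMap.fourier_coe, hff, Real.fourierInv_eq'] at h2
  simp only [inner_zero_right, mul_zero, Complex.ofReal_zero, zero_mul, Complex.exp_zero,
    one_smul] at h2
  rw [← h2]
  simp_rw [angFourier_eq_fourier]
  rw [Measure.integral_comp_div, abs_of_pos Real.two_pi_pos]
  simp

lemma angFourier_comp_div (φ : ℝ → ℂ) {N : ℝ} (hN : 0 < N) (s : ℝ) :
    angFourier (fun ν => φ (ν / N)) s = N * angFourier φ (N * s) := by
  have := Measure.integral_comp_div (fun ν : ℝ => phase (-(ν * (N * s))) * φ ν) N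
  rw [angFourier, angFourier, ← Complex.real_smul]
  rw [abs_of_pos hN] at this
  rw [← this]
  congr 1; ext ν
  congr 3; field_simp

/-! ### Weak convergence in `L²` -/

/-- A bounded curve in a Hilbert space whose products with the elements of a total set converge
is weakly convergent. -/
lemma exists_weak_limit {ι H : Type*} [NormedAddCommGroup H] [InnerProductSpace ℂ H]
    [CompleteSpace H] {l : Filter ι} [l.NeBot] {w : ι → H} {C : ℝ} (hC : ∀ t, ‖w t‖ ≤ C)
    (S : Set H) (hS : ∀ x, (∀ s ∈ S, inner ℂ s x = 0) → x = 0)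
    (hconv : ∀ s ∈ S, ∃ c, Tendsto (fun t => inner ℂ s (w t)) l (𝓝 c)) :
    ∃ x, ∀ g, Tendsto (fun t => inner ℂ g (w t)) l (𝓝 (inner ℂ g x)) := by
  set W : ι → WeakDual ℂ H := fun t => StrongDual.toWeakDual (InnerProductSpace.toDual ℂ H (w t))
    with hW
  have hWa : ∀ t g, W t g = inner ℂ (w t) g := fun t g => rfl
  have hK := WeakDual.isCompact_closedBall (𝕜 := ℂ) (E := H) 0 C
  have hmem : ∀ t, W t ∈ (WeakDual.toStrongDual ⁻¹' Metric.closedBall (0 : StrongDual ℂ H) C) := by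
    intro t
    have : ‖InnerProductSpace.toDual ℂ H (w t)‖ ≤ C := by simpa using hC t
    simpa [hW] using this
  -- By Banach-Alaoglu it suffices that cluster points are unique. A cluster point is prescribed on
  -- `S` by the assumed limits, and `S` is total. The conjugates appear because `W t` pairs with `w
  -- t` in the first slot.
  have key : ∀ x : WeakDual ℂ H, ClusterPt x (map W l) → ∀ s c,
      Tendsto (fun t => inner ℂ s (w t)) l (𝓝 c) → x s = (starRingEnd ℂ) c := by
    intro x hx s c hc
    have h1 : MapClusterPt (x s) l (fun t => W t s) :=
      MapClusterPt.continuousAt_comp (f := fun y : WeakDual ℂ H => y s)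
        (WeakDual.eval_continuous s).continuousAt hx
    have h2 : Tendsto (fun t => W t s) l (𝓝 ((starRingEnd ℂ) c)) := by
      have := (Complex.continuous_conj.tendsto c).comp hc
      refine this.congr fun t => ?_
      simp [hWa]
    have h3 : NeBot (𝓝 (x s) ⊓ 𝓝 ((starRingEnd ℂ) c)) :=
      NeBot.mono h1 (inf_le_inf_left _ h2)
    exact eq_of_nhds_neBot h3
  obtain ⟨x, -, hx⟩ := hK.exists_clusterPt (f := map W l)
    (le_principal_iff.2 (mem_map.2 (univ_mem' hmem)))
  obtain ⟨x', rfl⟩ : ∃ x' : H, x = StrongDual.toWeakDual (InnerProductSpace.toDual ℂ H x') :=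
    ⟨(InnerProductSpace.toDual ℂ H).symm (WeakDual.toStrongDual x), by simp⟩
  have hlim : Tendsto W l (𝓝 (StrongDual.toWeakDual (InnerProductSpace.toDual ℂ H x'))) := by
    refine hK.le_nhds_of_unique_clusterPt (mem_map.2 (univ_mem' hmem)) ?_
    intro y _ hy
    obtain ⟨y', rfl⟩ : ∃ y' : H, y = StrongDual.toWeakDual (InnerProductSpace.toDual ℂ H y') :=
      ⟨(InnerProductSpace.toDual ℂ H).symm (WeakDual.toStrongDual y), by simp⟩
    have : y' - x' = 0 := by
      refine hS _ fun s hs => ?_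
      obtain ⟨c, hc⟩ := hconv s hs
      have e1 : inner ℂ y' s = (starRingEnd ℂ) c := key _ hy s c hc
      have e2 : inner ℂ x' s = (starRingEnd ℂ) c := key _ hx s c hc
      rw [inner_sub_right, ← inner_conj_symm s y', ← inner_conj_symm s x', e1, e2, sub_self]
    rw [sub_eq_zero.1 this]
  refine ⟨x', fun g => ?_⟩
  have h1 := ((WeakDual.eval_continuous (𝕜 := ℂ) g).tendsto _).comp hlim
  have h2 := (Complex.continuous_conj.tendsto _).comp h1
  have e : (starRingEnd ℂ) ((StrongDual.toWeakDual (InnerProductSpace.toDual ℂ H x')) g)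
      = inner ℂ g x' := inner_conj_symm g x'
  rw [e] at h2
  refine h2.congr fun t => ?_
  exact inner_conj_symm g (w t)

/-- Smooth real functions with compact support in `ℝ \ {0}`. -/
structure IsTestFunction (φ : ℝ → ℝ) : Prop where
  contDiff : ContDiff ℝ ∞ φ
  hasCompactSupport : HasCompactSupport φ
  zero_notMem : (0 : ℝ) ∉ tsupport φ

lemma IsTestFunction.continuous_div {φ κ : ℝ → ℝ} (hφ : IsTestFunction φ) (hκ : Continuous κ)
    (h0 : ∀ ν, κ ν = 0 → ν = 0) : Continuous fun ν => φ ν / κ ν := by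
  rw [continuous_iff_continuousAt]
  intro ν
  by_cases hν : ν ∈ tsupport φ
  · have : κ ν ≠ 0 := fun h => hφ.zero_notMem (h0 ν h ▸ hν)
    exact hφ.contDiff.continuous.continuousAt.div hκ.continuousAt this
  · have h : (fun ν => φ ν / κ ν) =ᶠ[𝓝 ν] fun _ => 0 := by
      filter_upwards [notMem_tsupport_iff_eventuallyEq.1 hν] with x hx
      simp [hx]
    exact continuousAt_const.congr h.symm

lemma IsTestFunction.hasCompactSupport_div {φ : ℝ → ℝ} (hφ : IsTestFunction φ) (κ : ℝ → ℝ) :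
    HasCompactSupport fun ν => φ ν / κ ν := by
  simp only [div_eq_mul_inv]
  exact hφ.hasCompactSupport.mul_right (f' := fun ν => (κ ν)⁻¹)

lemma IsTestFunction.memLp_div {φ κ : ℝ → ℝ} (hφ : IsTestFunction φ) (hκ : Continuous κ)
    (h0 : ∀ ν, κ ν = 0 → ν = 0) : MemLp (fun ν => ((φ ν / κ ν : ℝ) : ℂ)) 2 :=
  ((hφ.continuous_div hκ h0).memLp_of_hasCompactSupport (hφ.hasCompactSupport_div κ)).ofReal

lemma integrable_mul_of_memLp_two {f g : ℝ → ℂ} (hf : MemLp f 2) (hg : MemLp g 2) :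
    Integrable fun ν => f ν * g ν := hf.integrable_mul hg

/-- If `f ∈ L²` is orthogonal to all `φ / κ`, then it vanishes. -/
lemma ae_eq_zero_of_forall_test {κ : ℝ → ℝ} (hκ : Continuous κ) (h0 : ∀ ν, κ ν = 0 → ν = 0)
    {f : ℝ → ℂ} (hf : MemLp f 2)
    (h : ∀ φ, IsTestFunction φ → ∫ ν, ((φ ν / κ ν : ℝ) : ℂ) * f ν = 0) : f =ᵐ[volume] 0 := by
  -- This is the fundamental lemma of the calculus of variations for `κ⁻¹ f`, which is locally
  -- integrable only off the origin.
  have hU : IsOpen ({0}ᶜ : Set ℝ) := isOpen_compl_singleton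
  have hloc : LocallyIntegrableOn (fun ν => ((κ ν)⁻¹ : ℝ) • f ν) {0}ᶜ := by
    refine LocallyIntegrableOn.continuousOn_smul hU.isLocallyClosed ?_ ?_
    · exact ((hf.locallyIntegrable (by norm_num)).locallyIntegrableOn _)
    · exact hκ.continuousOn.inv₀ fun ν hν h => hν (h0 ν h)
  have hz := hU.ae_eq_zero_of_integral_contDiff_smul_eq_zero hloc ?_
  · have h0' : ∀ᵐ ν : ℝ, ν ≠ 0 := by simp [ae_iff, measure_singleton]
    filter_upwards [hz, h0'] with ν h1 h2
    have := h1 h2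
    rcases smul_eq_zero.1 this with h3 | h3
    · exact absurd (h0 ν (inv_eq_zero.1 h3)) h2
    · exact h3
  · intro g hg hgc hgs
    rw [← h g ⟨hg, hgc, fun hmem => hgs hmem rfl⟩]
    congr 1; ext ν
    rw [smul_smul, Complex.real_smul, div_eq_mul_inv]

/-- A bounded curve in `L²` whose products with all `φ / κ` converge is weakly convergent. -/
lemma exists_weak_limit_of_test {κ : ℝ → ℝ} (hκ : Continuous κ) (h0 : ∀ ν, κ ν = 0 → ν = 0)
    {l : Filter ℝ} [l.NeBot] {w : ℝ → ℝ → ℂ} (hw : ∀ t, MemLp (w t) 2) {C : ℝ}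
    (hC : ∀ t, ∫ ν, ‖w t ν‖ ^ 2 ≤ C)
    (hconv : ∀ φ, IsTestFunction φ →
      ∃ c, Tendsto (fun t => ∫ ν, ((φ ν / κ ν : ℝ) : ℂ) * w t ν) l (𝓝 c)) :
    ∃ W : ℝ → ℂ, MemLp W 2 ∧ ∀ g : ℝ → ℂ, MemLp g 2 →
      Tendsto (fun t => ∫ ν, g ν * w t ν) l (𝓝 (∫ ν, g ν * W ν)) := by
  have hin : ∀ (f g : ℝ → ℂ) (hf : MemLp f 2) (hg : MemLp g 2),
      inner ℂ (hf.toLp f) (hg.toLp g) = ∫ ν, (starRingEnd ℂ) (f ν) * g ν := by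
    intro f g hf hg
    rw [L2.inner_def]
    refine integral_congr_ae ?_
    filter_upwards [hf.coeFn_toLp, hg.coeFn_toLp] with ν h1 h2
    rw [h1, h2, RCLike.inner_apply']
  have hnorm : ∀ t, ‖(hw t).toLp (w t)‖ ≤ √C := by
    intro t
    refine Real.le_sqrt_of_sq_le ?_
    have e := inner_self_eq_norm_sq_to_K (𝕜 := ℂ) ((hw t).toLp (w t))
    rw [hin] at e
    have e2 : ∫ ν, (starRingEnd ℂ) (w t ν) * w t ν = ((∫ ν, ‖w t ν‖ ^ 2 : ℝ) : ℂ) := by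
      refine Eq.trans ?_ (integral_ofReal (𝕜 := ℂ))
      congr 1; ext ν
      rw [mul_comm, Complex.mul_conj, Complex.normSq_eq_norm_sq]
      simp
    rw [e2] at e
    have e3 : (∫ ν, ‖w t ν‖ ^ 2 : ℝ) = ‖(hw t).toLp (w t)‖ ^ 2 := by
      exact Complex.ofReal_injective (by rw [e]; simp)
    rw [← e3]; exact hC t
  set S : Set (Lp ℂ 2 (volume : Measure ℝ)) :=
    {s | ∃ (φ : ℝ → ℝ) (hφ : IsTestFunction φ), s = (hφ.memLp_div hκ h0).toLp _} with hSdef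
  have hS : ∀ x, (∀ s ∈ S, inner ℂ s x = 0) → x = 0 := by
    intro x hx
    have : (x : ℝ → ℂ) =ᵐ[volume] 0 := by
      refine ae_eq_zero_of_forall_test hκ h0 (Lp.memLp x) fun φ hφ => ?_
      have h := hx _ ⟨φ, hφ, rfl⟩
      rw [← Lp.toLp_coeFn x (Lp.memLp x), hin] at h
      rw [← h]; simp
    exact (Lp.eq_zero_iff_ae_eq_zero).2 this
  have hS' : ∀ s ∈ S, ∃ c, Tendsto (fun t => inner ℂ s ((hw t).toLp (w t))) l (𝓝 c) := by
    rintro s ⟨φ, hφ, rfl⟩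
    obtain ⟨c, hc⟩ := hconv φ hφ
    refine ⟨c, hc.congr fun t => ?_⟩
    rw [hin]; simp
  obtain ⟨x, hx⟩ := exists_weak_limit hnorm S hS hS'
  refine ⟨x, Lp.memLp x, fun g hg => ?_⟩
  have hg' : MemLp (fun ν => (starRingEnd ℂ) (g ν)) 2 := hg.star
  have := hx (hg'.toLp _)
  have ex : inner ℂ (hg'.toLp _) x = ∫ ν, g ν * x ν := by
    conv_lhs => rw [← Lp.toLp_coeFn x (Lp.memLp x)]
    rw [hin]; simp
  rw [ex] at this
  refine this.congr fun t => ?_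
  rw [hin]; simp

/-- A bounded curve in `L²` whose products with all `φ / κ` tend to `0` tends weakly to `0`. -/
lemma tendsto_zero_of_test {κ : ℝ → ℝ} (hκ : Continuous κ) (h0 : ∀ ν, κ ν = 0 → ν = 0)
    {l : Filter ℝ} [l.NeBot] {w : ℝ → ℝ → ℂ} (hw : ∀ t, MemLp (w t) 2) {C : ℝ}
    (hC : ∀ t, ∫ ν, ‖w t ν‖ ^ 2 ≤ C)
    (hconv : ∀ φ, IsTestFunction φ →
      Tendsto (fun t => ∫ ν, ((φ ν / κ ν : ℝ) : ℂ) * w t ν) l (𝓝 0))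
    {g : ℝ → ℂ} (hg : MemLp g 2) : Tendsto (fun t => ∫ ν, g ν * w t ν) l (𝓝 0) := by
  obtain ⟨W, hW, hlim⟩ := exists_weak_limit_of_test hκ h0 hw hC fun φ hφ => ⟨0, hconv φ hφ⟩
  have hW0 : W =ᵐ[volume] 0 := ae_eq_zero_of_forall_test hκ h0 hW fun φ hφ =>
    tendsto_nhds_unique (hlim _ (hφ.memLp_div hκ h0)) (hconv φ hφ)
  have := hlim g hg
  rwa [integral_congr_ae (g := fun _ => 0) (hW0.mono fun ν h => by simp [h]),
    integral_zero] at this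

/-! ### Tauberian arguments -/

lemma HasQuadraticDecay.integrable_bdd_mul {k : ℝ → ℂ} (hk : HasQuadraticDecay k) {f : ℝ → ℝ}
    (hf : Continuous f) {B : ℝ} (hB : ∀ t, |f t| ≤ B) : Integrable fun u => (f u : ℂ) * k u :=
  hk.integrable.bdd_mul (c := B) (Complex.continuous_ofReal.comp hf).aestronglyMeasurable
    (ae_of_all _ fun t => by simpa using hB t)

/-- Continuity of translation in `L¹`. For `|x| ≤ 1` the translates share one quadratic majorant,
since `1 + u² ≤ 3 (1 + (u - x)²)`. -/
lemma HasQuadraticDecay.tendsto_integral_norm_sub_shift {k : ℝ → ℂ} (hk : HasQuadraticDecay k) :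
    Tendsto (fun x : ℝ => ∫ u, ‖k (u - x) - k u‖) (𝓝 0) (𝓝 0) := by
  obtain ⟨C, hC0, hC⟩ := hk.bound
  have hc := hk.continuous
  have : Tendsto (fun x : ℝ => ∫ u, ‖k (u - x) - k u‖) (𝓝 0) (𝓝 (∫ _u : ℝ, (0 : ℝ))) := by
    refine tendsto_integral_filter_of_dominated_convergence
      (fun u => 4 * C * (1 + u ^ 2)⁻¹) ?_ ?_ (integrable_inv_one_add_sq.const_mul _) ?_
    · exact Eventually.of_forall fun x => by
        apply Continuous.aestronglyMeasurable; fun_prop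
    · filter_upwards [Metric.closedBall_mem_nhds (0 : ℝ) one_pos] with x hx
      refine ae_of_all _ fun u => ?_
      have hx2 : x ^ 2 ≤ 1 := by
        rw [Metric.mem_closedBall, dist_zero_right, Real.norm_eq_abs] at hx
        rw [← sq_abs]; nlinarith [abs_nonneg x]
      have h1 : (1 + (u - x) ^ 2)⁻¹ ≤ 3 * (1 + u ^ 2)⁻¹ := by
        rw [← div_eq_mul_inv, le_div_iff₀ (by positivity), inv_mul_le_iff₀ (by positivity)]
        nlinarith [sq_nonneg (u - 2 * x)]
      rw [norm_norm]
      calc ‖k (u - x) - k u‖ ≤ ‖k (u - x)‖ + ‖k u‖ := norm_sub_le _ _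
        _ ≤ C * (3 * (1 + u ^ 2)⁻¹) + C * (1 + u ^ 2)⁻¹ :=
          add_le_add ((hC _).trans (mul_le_mul_of_nonneg_left h1 hC0)) (hC _)
        _ = _ := by ring
    · refine ae_of_all _ fun u => ?_
      have : Continuous fun x : ℝ => ‖k (u - x) - k u‖ := by fun_prop
      simpa using this.tendsto 0
  simpa using this

/-- This integral bounds the error made in smoothing a bounded Lipschitz function at scale `1 / N`.
-/
lemma HasQuadraticDecay.tendsto_integral_min {k : ℝ → ℂ} (hk : HasQuadraticDecay k) {B V : ℝ}
    (hB : 0 ≤ B) (hV : 0 ≤ V) :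
    Tendsto (fun N : ℝ => ∫ u, min B (V * |u / N|) * ‖k u‖) atTop (𝓝 0) := by
  have hc := hk.continuous
  have : Tendsto (fun N : ℝ => ∫ u, min B (V * |u / N|) * ‖k u‖) atTop
      (𝓝 (∫ _u : ℝ, (0 : ℝ))) := by
    refine tendsto_integral_filter_of_dominated_convergence
      (fun u => B * ‖k u‖) ?_ ?_ (hk.integrable.norm.const_mul _) ?_
    · exact Eventually.of_forall fun x => by
        apply Continuous.aestronglyMeasurable; fun_prop
    · refine Eventually.of_forall fun N => ae_of_all _ fun u => ?_
      rw [Real.norm_of_nonneg (by positivity)]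
      gcongr
      exact min_le_left _ _
    · refine ae_of_all _ fun u => ?_
      have h1 : Tendsto (fun N : ℝ => u / N) atTop (𝓝 0) := tendsto_const_nhds.div_atTop tendsto_id
      have h2 : Continuous fun x : ℝ => min B (V * |x|) * ‖k u‖ := by fun_prop
      have := (h2.tendsto 0).comp h1
      simpa [min_eq_right hB, Function.comp_def] using this
  simpa using this

/-- A bounded Lipschitz function whose convolutions with the Fourier transforms of all test
functions supported away from `0` vanish at infinity is slowly varying. -/
lemma tendsto_shift_sub {q : ℝ → ℝ} {B V : ℝ} (hq : Continuous q) (hB : ∀ t, |q t| ≤ B)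
    (hV : 0 ≤ V) (hlip : ∀ s t, |q s - q t| ≤ V * |s - t|)
    (h : ∀ φ : ℝ → ℝ, IsTestFunction φ →
      Tendsto (fun t => ∫ u, (q (t + u) : ℂ) * angFourier (fun ν => (φ ν : ℂ)) u) atTop (𝓝 0))
    (a : ℝ) : Tendsto (fun t => q (t + a) - q t) atTop (𝓝 0) := by
  have hB0 : 0 ≤ B := (abs_nonneg _).trans (hB 0)
  let χ : ContDiffBump (0 : ℝ) := ⟨1, 2, one_pos, one_lt_two⟩
  have hχc : HasCompactSupport (fun ν => (χ ν : ℂ)) :=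
    χ.hasCompactSupport.comp_left (g := ((↑) : ℝ → ℂ)) Complex.ofReal_zero
  have hχd : ContDiff ℝ ∞ (fun ν => (χ ν : ℂ)) := Complex.ofRealCLM.contDiff.comp χ.contDiff
  set k : ℝ → ℂ := angFourier (fun ν => (χ ν : ℂ)) with hkdef
  have hk : HasQuadraticDecay k := hasQuadraticDecay_angFourier hχd hχc
  have hkint : ∫ u, k u = 2 * Real.pi := by
    rw [hkdef, integral_angFourier hχd hχc]
    have : χ 0 = 1 := χ.one_of_mem_closedBall (by simp [χ])
    simp [this]
  -- `A c` is, up to the factor `2π`, a low-pass filter of `q` with cutoff frequency of order `c`.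
  -- With a large cutoff it is close to `2π q`, with a small one it hardly changes under a shift by
  -- `a`, and the band in between is governed by the hypothesis `h`.
  set A : ℝ → ℝ → ℂ := fun c t => ∫ u, (q (t + u / c) : ℂ) * k u with hA
  have hAint : ∀ c t, Integrable fun u => (q (t + u / c) : ℂ) * k u := fun c t =>
    hk.integrable_bdd_mul (f := fun u => q (t + u / c)) (by fun_prop) fun u => hB _
  have hhigh : ∀ N t, ‖A N t - 2 * Real.pi * q t‖ ≤ ∫ u, min (2 * B) (V * |u / N|) * ‖k u‖ := by
    intro N t
    have e : A N t - 2 * Real.pi * q t = ∫ u, ((q (t + u / N) : ℂ) - q t) * k u := by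
      simp_rw [sub_mul]
      rw [integral_sub (hAint N t) (hk.integrable.const_mul _), integral_const_mul, hkint]
      ring
    rw [e]
    refine (norm_integral_le_integral_norm _).trans (integral_mono_of_nonneg
      (ae_of_all _ fun u => norm_nonneg _) ?_ (ae_of_all _ fun u => ?_))
    · refine (hk.integrable.norm.const_mul (2 * B)).mono' ?_ (ae_of_all _ fun u => ?_)
      · have := hk.continuous
        apply Continuous.aestronglyMeasurable; fun_prop
      · rw [Real.norm_of_nonneg (by positivity)]
        gcongr
        exact min_le_left _ _
    · simp only [norm_mul]
      gcongr
      rw [← Complex.ofReal_sub, Complex.norm_real, Real.norm_eq_abs]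
      refine le_min ?_ ?_
      · refine (abs_sub _ _).trans ?_
        linarith [hB (t + u / N), hB t]
      · simpa using hlip (t + u / N) t
  -- Shifting time by `a` shifts the kernel by only `ε * a` after rescaling.
  have hlow : ∀ ε > 0, ∀ t, ‖A ε (t + a) - A ε t‖ ≤ B * ∫ u, ‖k (u - ε * a) - k u‖ := by
    intro ε hε t
    have e1 : A ε (t + a) = ∫ u, (q (t + u / ε) : ℂ) * k (u - ε * a) := by
      rw [← integral_add_right_eq_self _ (ε * a)]
      simp only [hA]
      congr 1; ext u
      congr 3
      · field_simp; ring
      · ring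
    have hi : Integrable fun u => k (u - ε * a) := hk.integrable.comp_sub_right _
    have hi2 : Integrable fun u => (q (t + u / ε) : ℂ) * k (u - ε * a) :=
      hi.bdd_mul (c := B) (by apply Continuous.aestronglyMeasurable; fun_prop)
        (ae_of_all _ fun t => by simpa using hB _)
    have e : A ε (t + a) - A ε t = ∫ u, (q (t + u / ε) : ℂ) * (k (u - ε * a) - k u) := by
      simp_rw [mul_sub]
      rw [integral_sub hi2 (hAint ε t), e1]
    rw [e, ← integral_const_mul]
    refine (norm_integral_le_integral_norm _).trans (integral_mono_of_nonneg
      (ae_of_all _ fun u => norm_nonneg _) ((hi.sub hk.integrable).norm.const_mul _)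
      (ae_of_all _ fun u => ?_))
    simp only [norm_mul, Complex.norm_real, Real.norm_eq_abs]
    gcongr
    exact hB _
  -- Both cutoffs equal `1` near `0`, so their difference is a test function supported away from
  -- `0`.
  have hmid : ∀ N > 0, ∀ ε > 0, Tendsto (fun t => A N t - A ε t) atTop (𝓝 0) := by
    intro N hN ε hε
    have hscale : ∀ c > 0, HasCompactSupport (fun ν => χ (ν / c)) := fun c hc => by
      have := χ.hasCompactSupport.comp_homeomorph (Homeomorph.mulRight₀ c⁻¹ (inv_ne_zero hc.ne'))
      simpa [Function.comp_def, div_eq_mul_inv] using this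
    have hscaleC : ∀ c > 0, Integrable (fun ν => (χ (ν / c) : ℂ)) := fun c hc =>
      (Continuous.integrable_of_hasCompactSupport (by have := χ.continuous; fun_prop)
        (hscale c hc)).ofReal
    have htest : IsTestFunction fun ν => χ (ν / N) - χ (ν / ε) := by
      refine ⟨?_, (hscale N hN).sub (hscale ε hε), ?_⟩
      · exact (χ.contDiff.comp (contDiff_id.div_const N)).sub
          (χ.contDiff.comp (contDiff_id.div_const ε))
      · rw [notMem_tsupport_iff_eventuallyEq]
        filter_upwards [Metric.ball_mem_nhds (0 : ℝ) hN, Metric.ball_mem_nhds (0 : ℝ) hε]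
          with ν h1 h2
        have hone : ∀ c > 0, ν ∈ Metric.ball (0 : ℝ) c → χ (ν / c) = 1 := by
          intro c hc hm
          refine χ.one_of_mem_closedBall ?_
          simp only [Metric.mem_ball, dist_zero_right, Real.norm_eq_abs] at hm
          simp only [Metric.mem_closedBall, dist_zero_right, Real.norm_eq_abs, abs_div,
            abs_of_pos hc, χ]
          exact (div_le_one hc).2 hm.le
        simp [hone N hN h1, hone ε hε h2]
    refine (h _ htest).congr fun t => ?_
    have e1 : ∀ u, angFourier (fun ν => ((χ (ν / N) - χ (ν / ε) : ℝ) : ℂ)) u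
        = N * k (N * u) - ε * k (ε * u) := by
      intro u
      have hm : ∀ c > 0, Integrable fun ν => phase (-(ν * u)) * (χ (ν / c) : ℂ) := fun c hc =>
        (hscaleC c hc).bdd_mul (c := 1)
          (by have := continuous_phase; apply Continuous.aestronglyMeasurable; fun_prop)
          (ae_of_all _ fun t => by simp)
      rw [hkdef, ← angFourier_comp_div _ hN, ← angFourier_comp_div _ hε, angFourier, angFourier,
        angFourier, ← integral_sub (hm N hN) (hm ε hε)]
      congr 1; ext ν
      push_cast; ring
    have e2 : ∀ c > 0, ∀ u, (q (t + u) : ℂ) * (c * k (c * u)) =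
        c * ((fun u => (q (t + u / c) : ℂ) * k u) (c * u)) := by
      intro c hc u
      have : c * u / c = u := by field_simp
      simp only [this]; ring
    have e3 : ∀ c > 0, ∫ u, c * ((fun u => (q (t + u / c) : ℂ) * k u) (c * u)) = A c t := by
      intro c hc
      rw [integral_const_mul, Measure.integral_comp_mul_left (fun u => (q (t + u / c) : ℂ) * k u),
        abs_of_pos (inv_pos.2 hc), Complex.real_smul, ← mul_assoc]
      have : (c : ℂ) * (c⁻¹ : ℝ) = 1 := by
        rw [← Complex.ofReal_mul, mul_inv_cancel₀ hc.ne', Complex.ofReal_one]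
      rw [this, one_mul]
    have e4 : ∀ c > 0, Integrable fun u => c * ((fun u => (q (t + u / c) : ℂ) * k u) (c * u)) :=
      fun c hc => ((hAint c t).comp_mul_left' hc.ne').const_mul _
    simp_rw [e1, mul_sub, e2 N hN, e2 ε hε]
    rw [integral_sub (by simpa using e4 N hN) (by simpa using e4 ε hε), e3 N hN, e3 ε hε]
  rw [Metric.tendsto_nhds]
  intro δ hδ
  obtain ⟨N, hN0, hN⟩ : ∃ N > 0, ∫ u, min (2 * B) (V * |u / N|) * ‖k u‖ < δ := by
    have := (hk.tendsto_integral_min (B := 2 * B) (by positivity) hV).eventually_lt_const hδ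
    obtain ⟨N, h1, h2⟩ := (this.and (eventually_gt_atTop 0)).exists
    exact ⟨N, h2, h1⟩
  obtain ⟨ε, hε0, hε⟩ : ∃ ε > 0, B * ∫ u, ‖k (u - ε * a) - k u‖ < δ := by
    have h0 : Tendsto (fun ε : ℝ => ε * a) (𝓝[>] 0) (𝓝 0) := by
      have : Continuous fun ε : ℝ => ε * a := by fun_prop
      simpa using (this.tendsto 0).mono_left nhdsWithin_le_nhds
    have := ((hk.tendsto_integral_norm_sub_shift.comp h0).const_mul B)
    rw [mul_zero] at this
    obtain ⟨ε, h1, h2⟩ := ((this.eventually_lt_const hδ).and self_mem_nhdsWithin).exists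
    exact ⟨ε, h2, h1⟩
  have hm1 := Metric.tendsto_nhds.1 (hmid N hN0 ε hε0) δ hδ
  have hm2 := Metric.tendsto_nhds.1
    ((hmid N hN0 ε hε0).comp (tendsto_atTop_add_const_right _ a tendsto_id)) δ hδ
  filter_upwards [hm1, hm2] with t h1 h2
  simp only [dist_zero_right, Function.comp, id] at h1 h2 ⊢
  have h3 := hhigh N t
  have h4 := hhigh N (t + a)
  have h5 := hlow ε hε0 t
  -- Five error terms, each below `δ`, suffice because `5 < 2π`.
  have e : (2 * Real.pi * (q (t + a) - q t) : ℂ) = -(A N (t + a) - 2 * Real.pi * q (t + a))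
      + (A N t - 2 * Real.pi * q t) + (A N (t + a) - A ε (t + a)) - (A N t - A ε t)
      + (A ε (t + a) - A ε t) := by ring
  have hle : ‖(2 * Real.pi * (q (t + a) - q t) : ℂ)‖ < 5 * δ := by
    rw [e]
    refine (norm_add_le _ _).trans_lt ?_
    have n1 := norm_sub_le (-(A N (t + a) - 2 * Real.pi * q (t + a))
      + (A N t - 2 * Real.pi * q t) + (A N (t + a) - A ε (t + a))) (A N t - A ε t)
    have n2 := norm_add_le (-(A N (t + a) - 2 * Real.pi * q (t + a))
      + (A N t - 2 * Real.pi * q t)) (A N (t + a) - A ε (t + a))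
    have n3 := norm_add_le (-(A N (t + a) - 2 * Real.pi * q (t + a)))
      (A N t - 2 * Real.pi * q t)
    rw [norm_neg] at n3
    linarith
  have e' : ‖(2 * Real.pi * (q (t + a) - q t) : ℂ)‖ = 2 * Real.pi * ‖q (t + a) - q t‖ := by
    rw [← Complex.ofReal_sub, norm_mul, Complex.norm_real]
    congr 1
    simp [abs_of_pos Real.pi_pos]
  rw [e'] at hle
  nlinarith [Real.pi_gt_three, norm_nonneg (q (t + a) - q t)]

/-- If `f' = G + r` with `G` Lipschitz, `r → 0` and `f` slowly varying, then `G → 0`. -/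
lemma tendsto_zero_of_hasDerivAt {f G r : ℝ → ℝ} {L : ℝ} (hL : 0 ≤ L)
    (hf : ∀ t, HasDerivAt f (G t + r t) t)
    (hdiff : ∀ a, Tendsto (fun t => f (t + a) - f t) atTop (𝓝 0)) (hr : Tendsto r atTop (𝓝 0))
    (hG : ∀ s t, |G s - G t| ≤ L * |s - t|) : Tendsto G atTop (𝓝 0) := by
  rw [Metric.tendsto_nhds]
  intro ε hε
  -- Over a time `a` the function `G` moves by less than `ε / 3`. The mean value theorem on `[t, t +
  -- a]` then finds a point where `G + r` is small. Dividing by `L + 1` allows `L = 0`.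
  obtain ⟨a, ha, haL⟩ : ∃ a > 0, L * a < ε / 3 := by
    refine ⟨ε / 3 / (L + 1), by positivity, ?_⟩
    rw [mul_div_assoc', div_lt_iff₀ (by positivity)]
    nlinarith
  have h1 := Metric.tendsto_nhds.1 (hdiff a) (a * (ε / 3)) (by positivity)
  have h2 := eventually_forall_ge_atTop.2 (Metric.tendsto_nhds.1 hr (ε / 3) (by positivity))
  filter_upwards [h1, h2] with t h1 h2
  simp only [dist_zero_right, Real.norm_eq_abs] at h1 h2 ⊢
  obtain ⟨c, ⟨hc1, hc2⟩, hc⟩ := exists_hasDerivAt_eq_slope f (fun t => G t + r t)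
    (by linarith : t < t + a) (fun x _ => (hf x).continuousAt.continuousWithinAt) fun x _ => hf x
  have h3 : |G c + r c| < ε / 3 := by
    rw [hc, abs_div, add_sub_cancel_left, abs_of_pos ha, div_lt_iff₀ ha]
    linarith
  have h4 : |G c - G t| < ε / 3 := by
    refine (hG c t).trans_lt (lt_of_le_of_lt ?_ haL)
    gcongr
    rw [abs_of_pos (by linarith)]; linarith
  have h5 := h2 c hc1.le
  rw [abs_lt] at *
  constructor <;> linarith

/-- A bounded continuous function along which a function with isolated zeros tends to `0`
converges. -/
lemma exists_tendsto_of_isolated_zeros {q g : ℝ → ℝ} {B : ℝ} (hq : Continuous q)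
    (hB : ∀ t, |q t| ≤ B) (hg : Tendsto (fun t => g (q t)) atTop (𝓝 0))
    (hiso : ∀ x, g x = 0 → ∀ᶠ y in 𝓝[≠] x, g y ≠ 0) : ∃ c, Tendsto q atTop (𝓝 c) := by
  refine tendsto_of_no_upcrossings dense_univ ?_ ?_ ?_
  -- If `q` crossed from below `a` to above `b` forever, it would take every value of `[a, b]` at
  -- arbitrarily late times; `g` would vanish on the whole interval, so its zero at `a` would not be
  -- isolated.
  · rintro a - b - hab ⟨h1, h2⟩
    have hz : ∀ c ∈ Set.Icc a b, g c = 0 := by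
      intro c hc
      by_contra hne
      have hev : ∀ᶠ t in atTop, g (q t) ≠ g c :=
        hg.eventually_ne (Ne.symm hne)
      obtain ⟨T, hT⟩ := eventually_atTop.1 hev
      obtain ⟨t1, ht1, hq1⟩ := frequently_atTop.1 h1 T
      obtain ⟨t2, ht2, hq2⟩ := frequently_atTop.1 h2 T
      have hmem : c ∈ Set.uIcc (q t1) (q t2) := by
        rw [Set.mem_uIcc]; left; exact ⟨hq1.le.trans hc.1, hc.2.trans hq2.le⟩
      obtain ⟨t, ht, rfl⟩ := intermediate_value_uIcc hq.continuousOn hmem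
      exact hT t ((le_inf ht1 ht2).trans ht.1) rfl
    have h3 : ∀ᶠ y in 𝓝[>] a, g y ≠ 0 :=
      (hiso a (hz a ⟨le_rfl, hab.le⟩)).filter_mono (nhdsWithin_mono _ fun x hx => ne_of_gt hx)
    obtain ⟨y, hy1, hy2⟩ := (h3.and (Ioo_mem_nhdsGT hab)).exists
    exact hy1 (hz y ⟨hy2.1.le, hy2.2.le⟩)
  · exact isBoundedUnder_of ⟨B, fun t => (abs_le.1 (hB t)).2⟩
  · exact isBoundedUnder_of ⟨-B, fun t => (abs_le.1 (hB t)).1⟩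

/-! ### A single thermostat driven by a given force -/

/-- `x ν t`, `x' ν t` are the positions and velocities of a thermostat driven by `q`, with finite
energy at time `0`. -/
structure IsThermostat (κ q : ℝ → ℝ) (x x' : ℝ → ℝ → ℝ) : Prop where
  continuous_force : Continuous q
  memLp_coupling : MemLp κ 2
  hasDerivAt_pos : ∀ᵐ ν : ℝ, ∀ t : ℝ, HasDerivAt (x ν) (x' ν t) t
  hasDerivAt_vel : ∀ᵐ ν : ℝ, ∀ t : ℝ, HasDerivAt (x' ν) (-ν ^ 2 * x ν t + κ ν * q t) t
  finiteEnergy_zero : FiniteEnergy (fun ν => x ν 0) (fun ν => x' ν 0)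

/-- The complex amplitude `x' + i ν x`. -/
noncomputable def amp (x x' : ℝ → ℝ → ℝ) (t ν : ℝ) : ℂ := x' ν t + Complex.I * (ν * x ν t)

/-- `∫₀ᵗ exp (-i ν s) f(s) ds`. -/
noncomputable def truncFourier (f : ℝ → ℝ) (t ν : ℝ) : ℂ :=
  ∫ s in (0 : ℝ)..t, phase (-(ν * s)) * (f s : ℂ)

lemma continuous_truncFourier {f : ℝ → ℝ} (hf : Continuous f) (t : ℝ) :
    Continuous (truncFourier f t) := by
  have := continuous_phase
  exact intervalIntegral.continuous_parametric_intervalIntegral_of_continuous' (by fun_prop) _ _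

lemma norm_truncFourier_le (f : ℝ → ℝ) (t ν : ℝ) :
    ‖truncFourier f t ν‖ ≤ abs (∫ s in (0 : ℝ)..t, |f s|) := by
  refine (intervalIntegral.norm_integral_le_abs_integral_norm).trans (le_of_eq ?_)
  simp

/-- A bound uniform in `ν` and locally uniform in `t`, as needed to differentiate integrals over `ν`
under the integral sign. -/
lemma exists_truncFourier_bound {f : ℝ → ℝ} (hf : Continuous f) (t₀ : ℝ) :
    ∃ M, 0 ≤ M ∧ ∀ t ∈ Metric.ball t₀ 1, |f t| ≤ M ∧ ∀ ν, ‖truncFourier f t ν‖ ≤ M := by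
  have h1 : Continuous fun t => abs (∫ s in (0 : ℝ)..t, |f s|) :=
    (intervalIntegral.continuous_primitive
      (fun a b => (hf.abs).intervalIntegrable a b) 0).abs
  obtain ⟨M, hM⟩ := (isCompact_closedBall t₀ 1).exists_bound_of_continuousOn
    (h1.add hf.abs).continuousOn
  have hM' : ∀ t ∈ Metric.ball t₀ 1, abs (∫ s in (0 : ℝ)..t, |f s|) + |f t| ≤ M := fun t ht =>
    (le_abs_self _).trans (hM t (Metric.ball_subset_closedBall ht))
  refine ⟨M, ?_, fun t ht => ⟨?_, fun ν => ?_⟩⟩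
  · exact le_trans (by positivity) (hM' t₀ (Metric.mem_ball_self one_pos))
  · exact le_trans (le_add_of_nonneg_left (abs_nonneg _)) (hM' t ht)
  · exact (norm_truncFourier_le f t ν).trans
      (le_trans (le_add_of_nonneg_right (abs_nonneg _)) (hM' t ht))

/-- Duhamel formula for `z' = i ν z + c f`. -/
lemma eq_of_hasDerivAt_oscillator {z : ℝ → ℂ} {f : ℝ → ℝ} {ν : ℝ} {c : ℂ} (hf : Continuous f)
    (hz : ∀ t, HasDerivAt z (Complex.I * ν * z t + c * f t) t) (t : ℝ) :
    z t = phase (ν * t) * (z 0 + c * truncFourier f t ν) := by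
  have hph := continuous_phase
  have hu : ∀ s, HasDerivAt (fun s => phase (-(ν * s)) * z s)
      (c * (phase (-(ν * s)) * f s)) s := by
    intro s
    have h1 := hasDerivAt_phase_mul (-ν) s
    simp only [neg_mul] at h1
    refine (h1.mul (hz s)).congr_deriv ?_
    push_cast; ring
  have h2 := intervalIntegral.integral_eq_sub_of_hasDerivAt (a := 0) (b := t) (fun s _ => hu s)
    (Continuous.intervalIntegrable (by fun_prop) _ _)
  rw [intervalIntegral.integral_const_mul] at h2
  simp only [mul_zero, neg_zero, phase_zero, one_mul] at h2
  rw [truncFourier, h2, add_sub_cancel, ← mul_assoc, mul_comm (phase _) (phase _),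
    phase_neg_mul_phase, one_mul]

lemma norm_amp_sq (x x' : ℝ → ℝ → ℝ) (t ν : ℝ) :
    ‖amp x x' t ν‖ ^ 2 = x' ν t ^ 2 + ν ^ 2 * x ν t ^ 2 := by
  rw [← Complex.normSq_eq_norm_sq, Complex.normSq_apply]
  simp [amp]; ring

lemma finiteEnergy_iff_memLp_amp (x x' : ℝ → ℝ → ℝ) (t : ℝ) :
    FiniteEnergy (fun ν => x ν t) (fun ν => x' ν t) ↔ MemLp (amp x x' t) 2 := by
  rw [← memLp_re_im_iff]
  simp [FiniteEnergy, amp]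

lemma thermostatEnergy_eq (x x' : ℝ → ℝ → ℝ) (t : ℝ) :
    thermostatEnergy (fun ν => x ν t) (fun ν => x' ν t) = (1 / 2) * ∫ ν, ‖amp x x' t ν‖ ^ 2 := by
  simp_rw [norm_amp_sq]; rfl

lemma abs_vel_le_norm_amp (x x' : ℝ → ℝ → ℝ) (t ν : ℝ) : |x' ν t| ≤ ‖amp x x' t ν‖ := by
  simpa [amp] using Complex.abs_re_le_norm (amp x x' t ν)

namespace IsThermostat

variable {κ q : ℝ → ℝ} {x x' : ℝ → ℝ → ℝ}

/-- The amplitude turns the second-order equation into `a' = iνa + κq`. The exceptional null set of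
frequencies does not depend on `t`. -/
lemma amp_eq (h : IsThermostat κ q x x') : ∀ᵐ ν : ℝ, ∀ t,
    amp x x' t ν = phase (ν * t) * (amp x x' 0 ν + κ ν * truncFourier q t ν) := by
  filter_upwards [h.hasDerivAt_pos, h.hasDerivAt_vel] with ν h1 h2 t
  refine eq_of_hasDerivAt_oscillator (z := fun t => amp x x' t ν) h.continuous_force
    (fun t => ?_) t
  have := (h2 t).ofReal_comp.add (((h1 t).ofReal_comp.const_mul (ν : ℂ)).const_mul Complex.I)
  refine this.congr_deriv ?_
  simp only [amp]; push_cast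
  linear_combination (-(ν ^ 2 * x ν t) : ℂ) * Complex.I_sq

lemma memLp_coupling_mul (h : IsThermostat κ q x x') {f : ℝ → ℝ} (hf : Continuous f) (t : ℝ) :
    MemLp (fun ν => (κ ν : ℂ) * truncFourier f t ν) 2 := by
  refine (h.memLp_coupling.ofReal (K := ℂ)).of_le_mul (c := abs (∫ s in (0 : ℝ)..t, |f s|)) ?_
    (ae_of_all _ fun ν => ?_)
  · exact (h.memLp_coupling.ofReal (K := ℂ)).1.mul
      (continuous_truncFourier hf t).aestronglyMeasurable
  · rw [norm_mul, mul_comm]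
    gcongr
    · exact norm_truncFourier_le f t ν
    · rfl

lemma memLp_phase_mul {f : ℝ → ℂ} (hf : MemLp f 2) (t : ℝ) :
    MemLp (fun ν => phase (ν * t) * f ν) 2 := by
  have hph := continuous_phase
  refine hf.of_le ?_ (ae_of_all _ fun ν => by simp)
  exact AEStronglyMeasurable.mul (Continuous.aestronglyMeasurable (by fun_prop)) hf.1

lemma memLp_amp_zero (h : IsThermostat κ q x x') : MemLp (amp x x' 0) 2 :=
  (finiteEnergy_iff_memLp_amp x x' 0).1 h.finiteEnergy_zero

lemma memLp_amp (h : IsThermostat κ q x x') (t : ℝ) : MemLp (amp x x' t) 2 :=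
  (memLp_congr_ae (h.amp_eq.mono fun _ hν => hν t)).2 <|
    memLp_phase_mul (h.memLp_amp_zero.add (h.memLp_coupling_mul h.continuous_force t)) t

lemma finiteEnergy (h : IsThermostat κ q x x') (t : ℝ) :
    FiniteEnergy (fun ν => x ν t) (fun ν => x' ν t) :=
  (finiteEnergy_iff_memLp_amp x x' t).2 (h.memLp_amp t)

lemma norm_amp_le (h : IsThermostat κ q x x') : ∀ᵐ ν : ℝ, ∀ t,
    ‖amp x x' t ν‖ ≤ ‖amp x x' 0 ν‖ + |κ ν| * ‖truncFourier q t ν‖ := by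
  filter_upwards [h.amp_eq] with ν hν t
  rw [hν t, norm_mul, norm_phase, one_mul]
  exact (norm_add_le _ _).trans (by simp)

lemma memLp_vel (h : IsThermostat κ q x x') (t : ℝ) : MemLp (fun ν => x' ν t) 2 :=
  (h.finiteEnergy t).1

lemma memLp_mul_pos (h : IsThermostat κ q x x') (t : ℝ) : MemLp (fun ν => ν * x ν t) 2 :=
  (h.finiteEnergy t).2

lemma integrable_coupling_mul_norm (h : IsThermostat κ q x x') (M : ℝ) :
    Integrable fun ν => |κ ν| * (‖amp x x' 0 ν‖ + |κ ν| * M) :=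
  h.memLp_coupling.norm.integrable_mul
    (h.memLp_amp_zero.norm.add (h.memLp_coupling.norm.mul_const M))

/-- The power transferred to the thermostat. -/
lemma hasDerivAt_energy (h : IsThermostat κ q x x') (t₀ : ℝ) :
    HasDerivAt (fun t => thermostatEnergy (fun ν => x ν t) (fun ν => x' ν t))
      (q t₀ * ∫ ν, κ ν * x' ν t₀) t₀ := by
  obtain ⟨M, hM0, hM⟩ := exists_truncFourier_bound h.continuous_force t₀
  have hd := (hasDerivAt_integral_of_dominated_loc_of_deriv_le
    (F := fun t ν => x' ν t ^ 2 + ν ^ 2 * x ν t ^ 2)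
    (F' := fun t ν => 2 * (q t * (κ ν * x' ν t)))
    (bound := fun ν => 2 * (M * (|κ ν| * (‖amp x x' 0 ν‖ + |κ ν| * M))))
    (μ := volume) (x₀ := t₀) (Metric.ball_mem_nhds t₀ one_pos) ?_ ?_ ?_ ?_ ?_ ?_).2
  · simp only [thermostatEnergy]
    refine (hd.const_mul (1 / 2)).congr_deriv ?_
    rw [integral_const_mul, integral_const_mul]; ring
  · refine Eventually.of_forall fun t => ?_
    have := (h.memLp_amp t).1.norm.pow 2
    exact this.congr (ae_of_all _ fun ν => norm_amp_sq x x' t ν)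
  · have := (h.memLp_amp t₀).norm.integrable_sq
    simpa only [norm_amp_sq] using this
  · exact ((h.memLp_coupling.1.mul (h.memLp_vel t₀).1).const_mul _).const_mul _
  · filter_upwards [h.norm_amp_le] with ν hν t ht
    obtain ⟨h1, h2⟩ := hM t ht
    simp only [Real.norm_eq_abs, abs_mul, abs_two]
    gcongr
    refine (abs_vel_le_norm_amp x x' t ν).trans ((hν t).trans ?_)
    gcongr
    exact h2 ν
  · exact ((h.integrable_coupling_mul_norm M).const_mul _).const_mul _
  -- The two terms `2ν²xx'` cancel, so no unbounded power of `ν` has to be dominated.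
  · filter_upwards [h.hasDerivAt_pos, h.hasDerivAt_vel] with ν h1 h2 t _
    refine (((h2 t).pow 2).add (((h1 t).pow 2).const_mul (ν ^ 2))).congr_deriv ?_
    push_cast; ring

lemma hasDerivAt_coupling (h : IsThermostat κ q x x')
    (hint : ∀ t, Integrable fun ν => κ ν * x ν t) (t₀ : ℝ) :
    HasDerivAt (fun t => ∫ ν, κ ν * x ν t) (∫ ν, κ ν * x' ν t₀) t₀ := by
  obtain ⟨M, hM0, hM⟩ := exists_truncFourier_bound h.continuous_force t₀
  refine (hasDerivAt_integral_of_dominated_loc_of_deriv_le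
    (F := fun t ν => κ ν * x ν t) (F' := fun t ν => κ ν * x' ν t)
    (bound := fun ν => |κ ν| * (‖amp x x' 0 ν‖ + |κ ν| * M))
    (μ := volume) (x₀ := t₀) (Metric.ball_mem_nhds t₀ one_pos) ?_ (hint t₀) ?_ ?_
    (h.integrable_coupling_mul_norm M) ?_).2
  · exact Eventually.of_forall fun t => (hint t).1
  · exact h.memLp_coupling.1.mul (h.memLp_vel t₀).1
  · filter_upwards [h.norm_amp_le] with ν hν t ht
    simp only [Real.norm_eq_abs, abs_mul]
    gcongr
    refine (abs_vel_le_norm_amp x x' t ν).trans ((hν t).trans ?_)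
    gcongr
    exact (hM t ht).2 ν
  · filter_upwards [h.hasDerivAt_pos] with ν h1 t _
    exact (h1 t).const_mul _

end IsThermostat

/-! ### The amplitude relative to the instantaneous equilibrium -/

/-- The amplitude relative to the equilibrium position `κ(ν) q / ν²`. -/
noncomputable def shiftedAmp (κ q : ℝ → ℝ) (x x' : ℝ → ℝ → ℝ) (t ν : ℝ) : ℂ :=
  amp x x' t ν - Complex.I * ((κ ν / ν : ℝ) * q t)

/-- Near the origin `κ(ν) = O(ν)` by differentiability, and outside a ball of radius `δ` the
quotient is at most `|κ| / δ`. -/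
lemma memLp_coupling_div {κ : ℝ → ℝ} (hκ : DifferentiableAt ℝ κ 0) (h0 : κ 0 = 0)
    (h2 : MemLp κ 2) : MemLp (fun ν => κ ν / ν) 2 := by
  obtain ⟨C, hC⟩ := (hκ.isBigO_sub).bound
  obtain ⟨δ, hδ, hball⟩ := Metric.eventually_nhds_iff_ball.1 hC
  have hb : MemLp ((Metric.ball (0 : ℝ) δ).indicator fun _ => |C|) 2 :=
    memLp_indicator_const 2 measurableSet_ball _ (Or.inr measure_ball_lt_top.ne)
  refine (hb.add (h2.norm.mul_const δ⁻¹)).of_le (h2.1.mul measurable_inv.aestronglyMeasurable)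
    (ae_of_all _ fun ν => ?_)
  simp only [Pi.add_apply, Real.norm_eq_abs]
  rw [abs_of_nonneg (a := _ + |κ ν| * δ⁻¹) (add_nonneg
    (Set.indicator_nonneg (fun _ _ => abs_nonneg _) _)
    (by positivity)), abs_div]
  by_cases hν : ν ∈ Metric.ball (0 : ℝ) δ
  · rw [Set.indicator_of_mem hν]
    have h3 := hball ν hν
    rw [h0, sub_zero, sub_zero, Real.norm_eq_abs, Real.norm_eq_abs] at h3
    refine le_trans ?_ (le_add_of_nonneg_right (by positivity))
    refine div_le_of_le_mul₀ (abs_nonneg _) (abs_nonneg _) (h3.trans ?_)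
    gcongr
    exact le_abs_self C
  · rw [Set.indicator_of_notMem hν, zero_add, div_eq_mul_inv]
    gcongr
    simpa using hν

lemma ae_ne_zero : ∀ᵐ ν : ℝ, ν ≠ 0 := by simp [ae_iff, measure_singleton]

namespace IsThermostat

variable {κ q : ℝ → ℝ} {x x' : ℝ → ℝ → ℝ}

lemma memLp_shiftedAmp (h : IsThermostat κ q x x') (hμ : MemLp (fun ν => κ ν / ν) 2) (t : ℝ) :
    MemLp (shiftedAmp κ q x x' t) 2 :=
  (h.memLp_amp t).sub (((hμ.ofReal (K := ℂ)).mul_const _).const_mul _)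

/-- Subtracting the equilibrium replaces the driving `κq` by `-i(κ/ν)v`. This is the gain: `v` tends
to `0`, while `q` need not. -/
lemma shiftedAmp_eq (h : IsThermostat κ q x x') {v : ℝ → ℝ} (hv : Continuous v)
    (hqv : ∀ t, HasDerivAt q (v t) t) : ∀ᵐ ν : ℝ, ∀ t,
    shiftedAmp κ q x x' t ν = phase (ν * t) *
      (shiftedAmp κ q x x' 0 ν + -Complex.I * (κ ν / ν : ℝ) * truncFourier v t ν) := by
  filter_upwards [h.hasDerivAt_pos, h.hasDerivAt_vel, ae_ne_zero] with ν h1 h2 hν t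
  refine eq_of_hasDerivAt_oscillator (z := fun t => shiftedAmp κ q x x' t ν) hv
    (fun t => ?_) t
  have := ((h2 t).ofReal_comp.add
    (((h1 t).ofReal_comp.const_mul (ν : ℂ)).const_mul Complex.I)).sub
    (((hqv t).ofReal_comp.const_mul ((κ ν / ν : ℝ) : ℂ)).const_mul Complex.I)
  refine this.congr_deriv ?_
  simp only [shiftedAmp, amp]; push_cast
  have hν' : (ν : ℂ) ≠ 0 := Complex.ofReal_ne_zero.2 hν
  have e : (κ ν : ℂ) = ν * (κ ν / ν) := by field_simp
  linear_combination (-(ν ^ 2 * x ν t - ν * (κ ν / ν) * q t) : ℂ) * Complex.I_sq + q t * e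

lemma _root_.TwoThermostats.coupling_mul_eq (κ : ℝ → ℝ) (x : ℝ → ℝ → ℝ) (t : ℝ) :
    (fun ν => κ ν * x ν t) =ᵐ[volume] fun ν => κ ν / ν * (ν * x ν t) := by
  filter_upwards [ae_ne_zero] with ν hν
  field_simp

/-- The energy relative to the instantaneous equilibrium. -/
lemma integral_norm_shiftedAmp_sq (h : IsThermostat κ q x x')
    (hμ : MemLp (fun ν => κ ν / ν) 2) (t : ℝ) :
    (1 / 2) * ∫ ν, ‖shiftedAmp κ q x x' t ν‖ ^ 2 =
      thermostatEnergy (fun ν => x ν t) (fun ν => x' ν t) - q t * (∫ ν, κ ν * x ν t)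
        + couplingConst κ * q t ^ 2 / 2 := by
  have i1 : Integrable fun ν => x' ν t ^ 2 + ν ^ 2 * x ν t ^ 2 := by
    simpa only [norm_amp_sq] using (h.memLp_amp t).norm.integrable_sq
  have i2 : Integrable fun ν => κ ν * x ν t :=
    (integrable_congr (coupling_mul_eq κ x t)).2 (hμ.integrable_mul (h.memLp_mul_pos t))
  have i3 : Integrable fun ν => κ ν ^ 2 / ν ^ 2 := by
    simpa only [div_pow] using hμ.integrable_sq
  have e : (fun ν => ‖shiftedAmp κ q x x' t ν‖ ^ 2) =ᵐ[volume] fun ν =>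
      (x' ν t ^ 2 + ν ^ 2 * x ν t ^ 2) - 2 * q t * (κ ν * x ν t)
        + q t ^ 2 * (κ ν ^ 2 / ν ^ 2) := by
    filter_upwards [ae_ne_zero] with ν hν
    rw [← Complex.normSq_eq_norm_sq, Complex.normSq_apply]
    simp only [shiftedAmp, amp]
    simp
    field_simp
    ring
  have i4 : Integrable fun ν =>
      (x' ν t ^ 2 + ν ^ 2 * x ν t ^ 2) - 2 * q t * (κ ν * x ν t) := i1.sub (i2.const_mul _)
  rw [integral_congr_ae e, integral_add i4 (i3.const_mul _), integral_sub i1 (i2.const_mul _),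
    integral_const_mul, integral_const_mul, thermostatEnergy,
    couplingConst]
  ring

/-- The force exerted by the thermostat, relative to the instantaneous equilibrium. -/
lemma integral_coupling_eq (h : IsThermostat κ q x x')
    (hμ : MemLp (fun ν => κ ν / ν) 2) (t : ℝ) :
    ∫ ν, κ ν * x ν t = (∫ ν, ((κ ν / ν : ℝ) : ℂ) * shiftedAmp κ q x x' t ν).im
      + couplingConst κ * q t := by
  have i1 : Integrable fun ν => ((κ ν / ν : ℝ) : ℂ) * shiftedAmp κ q x x' t ν :=
    integrable_mul_of_memLp_two hμ.ofReal (h.memLp_shiftedAmp hμ t)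
  have i3 : Integrable fun ν => κ ν ^ 2 / ν ^ 2 := by
    simpa only [div_pow] using hμ.integrable_sq
  have e1 : (∫ ν, ((κ ν / ν : ℝ) : ℂ) * shiftedAmp κ q x x' t ν).im
      = ∫ ν, (((κ ν / ν : ℝ) : ℂ) * shiftedAmp κ q x x' t ν).im :=
    (integral_im i1).symm
  have i1' : Integrable fun ν => (((κ ν / ν : ℝ) : ℂ) * shiftedAmp κ q x x' t ν).im := i1.im
  rw [e1, couplingConst, ← integral_mul_const, ← integral_add i1' (i3.mul_const _)]
  refine integral_congr_ae ?_
  filter_upwards [ae_ne_zero] with ν hν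
  simp only [shiftedAmp, amp, Complex.im_ofReal_mul]
  simp
  field_simp
  ring

end IsThermostat

/-! ### Weak limits of the amplitudes -/

/-- Fubini; it converts pairings in frequency into time integrals against a Fourier transform. -/
lemma integral_mul_truncFourier {ψ : ℝ → ℂ} (hψ : Integrable ψ) {f : ℝ → ℝ} (hf : Continuous f)
    (t : ℝ) : ∫ ν, ψ ν * truncFourier f t ν = ∫ s in (0 : ℝ)..t, (f s : ℂ) * angFourier ψ s := by
  have hph := continuous_phase
  have hint : Integrable (Function.uncurry fun s ν => phase (-(ν * s)) * ((f s : ℂ) * ψ ν))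
      ((volume.restrict (Set.uIoc 0 t)).prod volume) := by
    have h1 : Integrable (fun s => (f s : ℂ)) (volume.restrict (Set.uIoc 0 t)) :=
      (intervalIntegrable_iff.1 (hf.intervalIntegrable 0 t)).ofReal
    refine (h1.mul_prod hψ).bdd_mul (c := 1) ?_ (ae_of_all _ fun p => by simp)
    apply Continuous.aestronglyMeasurable
    fun_prop
  have := intervalIntegral_integral_swap hint
  calc ∫ ν, ψ ν * truncFourier f t ν
      = ∫ ν, ∫ s in (0 : ℝ)..t, phase (-(ν * s)) * ((f s : ℂ) * ψ ν) := by
        congr 1; ext ν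
        rw [truncFourier, ← intervalIntegral.integral_const_mul]
        congr 1; ext s; ring
    _ = ∫ s in (0 : ℝ)..t, ∫ ν, phase (-(ν * s)) * ((f s : ℂ) * ψ ν) := this.symm
    _ = _ := by
        congr 1; ext s
        rw [angFourier, ← integral_const_mul]
        congr 1; ext ν; ring

lemma angFourier_phase_mul (ψ : ℝ → ℂ) (t s : ℝ) :
    angFourier (fun ν => phase (ν * t) * ψ ν) s = angFourier ψ (s - t) := by
  rw [angFourier, angFourier]
  congr 1; ext ν
  rw [← mul_assoc, ← phase_add]
  congr 2; ring

lemma angFourier_neg (ψ : ℝ → ℂ) (t : ℝ) : angFourier ψ (-t) = ∫ ν, phase (ν * t) * ψ ν := by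
  simp [angFourier]

lemma tendsto_integral_phase_mul (ψ : ℝ → ℂ) :
    Tendsto (fun t => ∫ ν, phase (ν * t) * ψ ν) atTop (𝓝 0) := by
  simp_rw [← angFourier_neg]
  exact (tendsto_angFourier_cocompact ψ).comp
    ((tendsto_neg_atTop_atBot (G := ℝ)).mono_right atBot_le_cocompact)

lemma integrable_phase_mul {ψ : ℝ → ℂ} (hψ : Integrable ψ) (t : ℝ) :
    Integrable fun ν => phase (ν * t) * ψ ν := by
  have hph := continuous_phase
  refine hψ.bdd_mul (c := 1) (Continuous.aestronglyMeasurable (by fun_prop))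
    (ae_of_all _ fun p => by simp)

/-- Putting the moving domain into an indicator prepares dominated convergence over the whole line.
-/
lemma setIntegral_comp_sub (S : Set ℝ) (hS : MeasurableSet S) (f : ℝ → ℝ) (k : ℝ → ℂ) (t : ℝ) :
    ∫ s in S, (f s : ℂ) * k (s - t) =
      ∫ u, ((· + t) ⁻¹' S).indicator (fun u => (f (t + u) : ℂ) * k u) u := by
  rw [← integral_indicator hS, ← integral_add_right_eq_self _ t]
  congr 1; ext u
  by_cases hu : u + t ∈ S
  · rw [Set.indicator_of_mem hu, Set.indicator_of_mem (by simpa using hu), add_comm u t,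
      add_sub_cancel_left]
  · rw [Set.indicator_of_notMem hu, Set.indicator_of_notMem (by simpa using hu)]

/-- A convolution with a function vanishing at infinity vanishes at infinity. -/
lemma HasQuadraticDecay.tendsto_intervalIntegral_zero {k : ℝ → ℂ} (hk : HasQuadraticDecay k)
    {v : ℝ → ℝ} (hv : Continuous v) {B : ℝ} (hB : ∀ t, |v t| ≤ B)
    (hv0 : Tendsto v atTop (𝓝 0)) :
    Tendsto (fun t => ∫ s in (0 : ℝ)..t, (v s : ℂ) * k (s - t)) atTop (𝓝 0) := by
  have hkc := hk.continuous
  have hB0 : 0 ≤ B := (abs_nonneg _).trans (hB 0)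
  have : Tendsto (fun t => ∫ u, ((· + t) ⁻¹' Set.Ioc 0 t).indicator
      (fun u => (v (t + u) : ℂ) * k u) u) atTop (𝓝 (∫ _u : ℝ, (0 : ℂ))) := by
    refine tendsto_integral_filter_of_dominated_convergence (fun u => B * ‖k u‖) ?_ ?_
      (hk.integrable.norm.const_mul _) ?_
    · refine Eventually.of_forall fun t => ?_
      refine AEStronglyMeasurable.indicator (Continuous.aestronglyMeasurable (by fun_prop)) ?_
      exact measurableSet_Ioc.preimage (measurable_add_const t)
    · refine Eventually.of_forall fun t => ae_of_all _ fun u => ?_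
      refine (norm_indicator_le_norm_self _ _).trans ?_
      rw [norm_mul, Complex.norm_real]
      gcongr
      exact hB _
    · refine ae_of_all _ fun u => ?_
      have h1 : Tendsto (fun t => ‖(v (t + u) : ℂ) * k u‖) atTop (𝓝 0) := by
        have h2 := hv0.comp (tendsto_atTop_add_const_right _ u tendsto_id)
        have h3 := ((Complex.continuous_ofReal.tendsto 0).comp h2).mul_const (k u)
        simpa [Function.comp_def] using h3.norm
      exact squeeze_zero_norm (fun t => norm_indicator_le_norm_self _ _) h1
  rw [integral_zero] at this
  refine this.congr' ?_
  filter_upwards [eventually_ge_atTop 0] with t ht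
  rw [intervalIntegral.integral_of_le ht, setIntegral_comp_sub _ measurableSet_Ioc]

/-- The missing part is the tail `u ≤ -t` of an integrable function times a bounded one. -/
lemma HasQuadraticDecay.tendsto_integral_sub_Ioi {k : ℝ → ℂ} (hk : HasQuadraticDecay k)
    {q : ℝ → ℝ} (hq : Continuous q) {B : ℝ} (hB : ∀ t, |q t| ≤ B) :
    Tendsto (fun t => (∫ u, (q (t + u) : ℂ) * k u) - ∫ s in Set.Ioi (0 : ℝ), (q s : ℂ) * k (s - t))
      atTop (𝓝 0) := by
  have hkc := hk.continuous
  have : Tendsto (fun t => ∫ u, (q (t + u) : ℂ) * k u -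
      ((· + t) ⁻¹' Set.Ioi 0).indicator (fun u => (q (t + u) : ℂ) * k u) u) atTop
      (𝓝 (∫ _u : ℝ, (0 : ℂ))) := by
    refine tendsto_integral_filter_of_dominated_convergence (fun u => B * ‖k u‖) ?_ ?_
      (hk.integrable.norm.const_mul _) ?_
    · refine Eventually.of_forall fun t => ?_
      refine AEStronglyMeasurable.sub (Continuous.aestronglyMeasurable (by fun_prop))
        (AEStronglyMeasurable.indicator (Continuous.aestronglyMeasurable (by fun_prop)) ?_)
      exact measurableSet_Ioi.preimage (measurable_add_const t)
    · refine Eventually.of_forall fun t => ae_of_all _ fun u => ?_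
      rw [← Pi.sub_apply (f := fun u => (q (t + u) : ℂ) * k u), ← Set.indicator_compl]
      refine (norm_indicator_le_norm_self _ _).trans ?_
      rw [norm_mul, Complex.norm_real]
      gcongr
      exact hB _
    · refine ae_of_all _ fun u => ?_
      refine tendsto_const_nhds.congr' ?_
      filter_upwards [eventually_gt_atTop (-u)] with t ht
      rw [Set.indicator_of_mem (by simp; linarith), sub_self]
  rw [integral_zero] at this
  refine this.congr fun t => ?_
  have hi : Integrable fun u => (q (t + u) : ℂ) * k u :=
    hk.integrable_bdd_mul (f := fun u => q (t + u)) (by fun_prop) fun u => hB _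
  rw [integral_sub hi (hi.indicator (measurableSet_Ioi.preimage (measurable_add_const t))),
    setIntegral_comp_sub _ measurableSet_Ioi]

namespace IsTestFunction

variable {φ : ℝ → ℝ}

lemma contDiff_ofReal (hφ : IsTestFunction φ) : ContDiff ℝ ∞ fun ν => (φ ν : ℂ) :=
  Complex.ofRealCLM.contDiff.comp hφ.contDiff

lemma hasCompactSupport_ofReal (hφ : IsTestFunction φ) : HasCompactSupport fun ν => (φ ν : ℂ) :=
  hφ.hasCompactSupport.comp_left (g := ((↑) : ℝ → ℂ)) Complex.ofReal_zero

lemma integrable_ofReal (hφ : IsTestFunction φ) : Integrable fun ν => (φ ν : ℂ) :=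
  hφ.contDiff_ofReal.continuous.integrable_of_hasCompactSupport hφ.hasCompactSupport_ofReal

lemma hasQuadraticDecay (hφ : IsTestFunction φ) :
    HasQuadraticDecay (angFourier fun ν => (φ ν : ℂ)) :=
  hasQuadraticDecay_angFourier hφ.contDiff_ofReal hφ.hasCompactSupport_ofReal

lemma apply_zero (hφ : IsTestFunction φ) : φ 0 = 0 :=
  image_eq_zero_of_notMem_tsupport hφ.zero_notMem

lemma div_mul_cancel (hφ : IsTestFunction φ) {κ : ℝ → ℝ} (h0 : ∀ ν, κ ν = 0 → ν = 0) (ν : ℝ) :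
    φ ν / κ ν * κ ν = φ ν := by
  by_cases h : κ ν = 0
  · rw [h0 ν h, hφ.apply_zero]; simp
  · exact div_mul_cancel₀ _ h

/-- Pairing `φ/κ` with the coefficient `κ/ν` of the shifted equation leaves `φ/ν`, again a test
function. -/
lemma div_id (hφ : IsTestFunction φ) : IsTestFunction fun ν => φ ν / ν := by
  have hsub : tsupport (fun ν => φ ν / ν) ⊆ tsupport φ := by
    refine closure_mono fun ν hν hφν => hν ?_
    simp [hφν]
  refine ⟨contDiff_iff_contDiffAt.2 fun ν => ?_, hφ.hasCompactSupport_div _,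
    fun h => hφ.zero_notMem (hsub h)⟩
  by_cases hν : ν ∈ tsupport φ
  · have : ν ≠ 0 := fun h => hφ.zero_notMem (h ▸ hν)
    exact hφ.contDiff.contDiffAt.div contDiffAt_id this
  · have h : (fun ν => φ ν / ν) =ᶠ[𝓝 ν] fun _ => 0 := by
      filter_upwards [notMem_tsupport_iff_eventuallyEq.1 hν] with x hx
      simp [hx]
    exact contDiffAt_const.congr_of_eventuallyEq h

end IsTestFunction

namespace IsThermostat

variable {κ q : ℝ → ℝ} {x x' : ℝ → ℝ → ℝ}

/-- The amplitude in the interaction picture converges weakly. -/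
lemma exists_weak_limit_amp (h : IsThermostat κ q x x') (hκ : Continuous κ)
    (h0 : ∀ ν, κ ν = 0 → ν = 0) {B C : ℝ} (hB : ∀ t, |q t| ≤ B)
    (hC : ∀ t, ∫ ν, ‖amp x x' t ν‖ ^ 2 ≤ C) :
    ∃ W : ℝ → ℂ, MemLp W 2 ∧ ∀ g : ℝ → ℂ, MemLp g 2 →
      Tendsto (fun t => ∫ ν, g ν * (amp x x' 0 ν + κ ν * truncFourier q t ν)) atTop
        (𝓝 (∫ ν, g ν * W ν)) := by
  refine exists_weak_limit_of_test hκ h0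
    (fun t => h.memLp_amp_zero.add (h.memLp_coupling_mul h.continuous_force t)) (C := C)
    (fun t => ?_) fun φ hφ => ?_
  · refine le_trans (le_of_eq (integral_congr_ae ?_)) (hC t)
    filter_upwards [h.amp_eq] with ν hν
    simp [hν t]
  · have i1 := integrable_mul_of_memLp_two (hφ.memLp_div hκ h0) h.memLp_amp_zero
    have i2 := fun t => integrable_mul_of_memLp_two (hφ.memLp_div hκ h0)
      (h.memLp_coupling_mul h.continuous_force t)
    have hlim := (intervalIntegral_tendsto_integral_Ioi 0
      (hφ.hasQuadraticDecay.integrable_bdd_mul h.continuous_force hB).integrableOn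
      tendsto_id).const_add (∫ ν, ((φ ν / κ ν : ℝ) : ℂ) * amp x x' 0 ν)
    refine ⟨_, hlim.congr fun t => ?_⟩
    simp_rw [mul_add]
    rw [integral_add i1 (i2 t), id, ← integral_mul_truncFourier hφ.integrable_ofReal
      h.continuous_force]
    congr 2; ext ν
    rw [← mul_assoc, ← Complex.ofReal_mul, hφ.div_mul_cancel h0]

/-- The convolutions of the force with test kernels vanish at infinity. -/
lemma tendsto_convolution_zero (h : IsThermostat κ q x x') (hκ : Continuous κ)
    (h0 : ∀ ν, κ ν = 0 → ν = 0) {B C : ℝ} (hB : ∀ t, |q t| ≤ B)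
    (hC : ∀ t, ∫ ν, ‖amp x x' t ν‖ ^ 2 ≤ C) {φ : ℝ → ℝ} (hφ : IsTestFunction φ) :
    Tendsto (fun t => ∫ u, (q (t + u) : ℂ) * angFourier (fun ν => (φ ν : ℂ)) u) atTop (𝓝 0) := by
  obtain ⟨W, hW, hlim⟩ := h.exists_weak_limit_amp hκ h0 hB hC
  have hk := hφ.hasQuadraticDecay
  have hdiv := hφ.memLp_div hκ h0
  -- For fixed `t`, let the upper time limit `T` go to infinity in the pairing with `e^{iνt} φ/κ`.
  -- The right side is then an oscillatory integral of a function independent of `t`.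
  have hmain : ∀ t, ∫ s in Set.Ioi (0 : ℝ), (q s : ℂ) * angFourier (fun ν => (φ ν : ℂ)) (s - t)
      = ∫ ν, phase (ν * t) * (((φ ν / κ ν : ℝ) : ℂ) * (W ν - amp x x' 0 ν)) := by
    intro t
    have hg := memLp_phase_mul hdiv t
    have l1 := (hlim _ hg).sub_const (∫ ν, (phase (ν * t) * ((φ ν / κ ν : ℝ) : ℂ)) * amp x x' 0 ν)
    have l2 := intervalIntegral_tendsto_integral_Ioi (μ := volume) (f := fun s =>
        (q s : ℂ) * angFourier (fun ν => (φ ν : ℂ)) (s - t)) 0 (Integrable.integrableOn ?_)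
      tendsto_id
    · have e : ∀ T, (∫ ν, phase (ν * t) * ((φ ν / κ ν : ℝ) : ℂ) *
          (amp x x' 0 ν + κ ν * truncFourier q T ν)) -
          ∫ ν, (phase (ν * t) * ((φ ν / κ ν : ℝ) : ℂ)) * amp x x' 0 ν =
          ∫ s in (0 : ℝ)..T, (q s : ℂ) * angFourier (fun ν => (φ ν : ℂ)) (s - t) := by
        intro T
        simp_rw [← angFourier_phase_mul]
        rw [← integral_mul_truncFourier (integrable_phase_mul hφ.integrable_ofReal t)
          h.continuous_force]
        simp_rw [mul_add]
        rw [integral_add (integrable_mul_of_memLp_two hg h.memLp_amp_zero)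
          (integrable_mul_of_memLp_two hg (h.memLp_coupling_mul h.continuous_force T)),
          add_sub_cancel_left]
        congr 1; ext ν
        rw [← mul_assoc, mul_assoc (phase _), ← Complex.ofReal_mul, hφ.div_mul_cancel h0]
      rw [tendsto_nhds_unique (l2.congr fun T => (e T).symm) l1,
        ← integral_sub (integrable_mul_of_memLp_two hg hW)
          (integrable_mul_of_memLp_two hg h.memLp_amp_zero)]
      congr 1; ext ν
      ring
    · exact (hk.integrable.comp_sub_right t).bdd_mul (c := B)
        (Complex.continuous_ofReal.comp h.continuous_force).aestronglyMeasurable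
        (ae_of_all _ fun s => by simpa using hB s)
  have l := (hk.tendsto_integral_sub_Ioi h.continuous_force hB).add
    (tendsto_integral_phase_mul fun ν => ((φ ν / κ ν : ℝ) : ℂ) * (W ν - amp x x' 0 ν))
  rw [add_zero] at l
  refine l.congr fun t => ?_
  rw [← hmain, sub_add_cancel]

/-- If the driving force is asymptotically constant, the amplitude relative to the instantaneous
equilibrium tends weakly to `0`. -/
lemma tendsto_integral_mul_shiftedAmp (h : IsThermostat κ q x x') (hκ : Continuous κ)
    (h0 : ∀ ν, κ ν = 0 → ν = 0) (hμ : MemLp (fun ν => κ ν / ν) 2) {v : ℝ → ℝ}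
    (hv : Continuous v) (hqv : ∀ t, HasDerivAt q (v t) t) {B C : ℝ} (hB : ∀ t, |v t| ≤ B)
    (hv0 : Tendsto v atTop (𝓝 0)) (hC : ∀ t, ∫ ν, ‖shiftedAmp κ q x x' t ν‖ ^ 2 ≤ C)
    {g : ℝ → ℂ} (hg : MemLp g 2) :
    Tendsto (fun t => ∫ ν, g ν * shiftedAmp κ q x x' t ν) atTop (𝓝 0) := by
  refine tendsto_zero_of_test hκ h0 (h.memLp_shiftedAmp hμ) hC (fun φ hφ => ?_) hg
  have hdiv := hφ.memLp_div hκ h0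
  -- The free evolution disappears by Riemann-Lebesgue; the forced part is a convolution with `v`,
  -- which vanishes at infinity.
  have l1 := tendsto_integral_phase_mul fun ν =>
    ((φ ν / κ ν : ℝ) : ℂ) * shiftedAmp κ q x x' 0 ν
  have l2 := (hφ.div_id.hasQuadraticDecay.tendsto_intervalIntegral_zero hv hB hv0).const_mul
    (-Complex.I)
  have l3 := l1.add l2
  rw [mul_zero, add_zero] at l3
  refine l3.congr fun t => ?_
  have i1 := integrable_phase_mul
    (integrable_mul_of_memLp_two hdiv (h.memLp_shiftedAmp hμ 0)) t
  have hφi := integrable_phase_mul hφ.div_id.integrable_ofReal t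
  have i2 : Integrable fun ν => -Complex.I *
      (phase (ν * t) * ((φ ν / ν : ℝ) : ℂ) * truncFourier v t ν) := by
    refine Integrable.const_mul ?_ _
    refine hφi.mul_bdd (c := abs (∫ s in (0 : ℝ)..t, |v s|))
      (continuous_truncFourier hv t).aestronglyMeasurable
      (ae_of_all _ fun ν => norm_truncFourier_le v t ν)
  simp_rw [← angFourier_phase_mul]
  rw [← integral_mul_truncFourier hφi hv, ← integral_const_mul, ← integral_add i1 i2]
  refine integral_congr_ae ?_
  filter_upwards [h.shiftedAmp_eq hv hqv] with ν hν
  rw [hν t]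
  have e : ((φ ν / κ ν : ℝ) : ℂ) * ((κ ν / ν : ℝ) : ℂ) = ((φ ν / ν : ℝ) : ℂ) := by
    rw [← Complex.ofReal_mul, mul_div_assoc', hφ.div_mul_cancel h0]
  rw [← e]; ring

end IsThermostat

/-! ### The coupled system -/

lemma abs_sub_le_of_hasDerivAt {f f' : ℝ → ℝ} {L : ℝ} (hf : ∀ t, HasDerivAt f (f' t) t)
    (hL : ∀ t, |f' t| ≤ L) (s t : ℝ) : |f s - f t| ≤ L * |s - t| :=
  convex_univ.norm_image_sub_le_of_norm_hasDerivWithin_le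
    (fun x _ => (hf x).hasDerivWithinAt) (fun x _ => hL x) (Set.mem_univ t) (Set.mem_univ s)

lemma IsCoupling.memLp_div {κ : ℝ → ℝ} (hκ : IsCoupling κ) : MemLp (fun ν => κ ν / ν) 2 :=
  memLp_coupling_div (hκ.contDiff.differentiable (by norm_num)).differentiableAt
    ((hκ.eq_zero_iff 0).2 rfl) hκ.memLp_two

lemma effPotential_apply (U κ : ℝ → ℝ) (q : ℝ) :
    effPotential U κ q = U q - couplingConst κ * q ^ 2 := by
  rw [effPotential, Fin.sum_univ_two]; ring

lemma contDiff_effPotential {U : ℝ → ℝ} (κ : ℝ → ℝ) (hU : ContDiff ℝ ∞ U) :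
    ContDiff ℝ ∞ (effPotential U κ) := by
  have : effPotential U κ = fun q => U q - couplingConst κ * q ^ 2 :=
    funext (effPotential_apply U κ)
  rw [this]
  fun_prop

lemma deriv_effPotential {U : ℝ → ℝ} (κ : ℝ → ℝ) (hU : ContDiff ℝ ∞ U) (q : ℝ) :
    deriv (effPotential U κ) q = deriv U q - 2 * couplingConst κ * q := by
  have : effPotential U κ = fun q => U q - couplingConst κ * q ^ 2 :=
    funext (effPotential_apply U κ)
  rw [this]
  have h1 : HasDerivAt U (deriv U q) q :=
    (hU.differentiable (by norm_num)).differentiableAt.hasDerivAt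
  refine (h1.sub ((hasDerivAt_pow 2 q).const_mul (couplingConst κ))).deriv.trans ?_
  push_cast; ring

lemma exists_bound_of_abs_le {f : ℝ → ℝ} (hf : Continuous f) (B : ℝ) :
    ∃ M, 0 ≤ M ∧ ∀ y, |y| ≤ B → |f y| ≤ M := by
  obtain ⟨M, hM⟩ := (isCompact_Icc (a := -B) (b := B)).exists_bound_of_continuousOn
    hf.continuousOn
  exact ⟨|M|, abs_nonneg _, fun y hy => (hM y (abs_le.1 hy)).trans (le_abs_self M)⟩

section

variable {U κ q v : ℝ → ℝ} {ξ ξ' : Fin 2 → ℝ → ℝ → ℝ}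

lemma IsSolution.isThermostat (hκ : IsCoupling κ) (hsol : IsSolution U κ q v ξ ξ')
    (hinit : ∀ m, FiniteEnergy (fun ν => ξ m ν 0) (fun ν => ξ' m ν 0)) (m : Fin 2) :
    IsThermostat κ q (ξ m) (ξ' m) where
  continuous_force := continuous_iff_continuousAt.2 fun t => (hsol.hasDerivAt_q t).continuousAt
  memLp_coupling := hκ.memLp_two
  hasDerivAt_pos := hsol.hasDerivAt_ξ m
  hasDerivAt_vel := hsol.hasDerivAt_ξ' m
  finiteEnergy_zero := hinit m

/-- Conservation of energy. -/
lemma IsSolution.exists_energy_eq (hU : ContDiff ℝ ∞ U) (hκ : IsCoupling κ)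
    (hsol : IsSolution U κ q v ξ ξ')
    (hinit : ∀ m, FiniteEnergy (fun ν => ξ m ν 0) (fun ν => ξ' m ν 0)) :
    ∃ H, ∀ t, v t ^ 2 / 2 + U (q t) +
      ∑ m, thermostatEnergy (fun ν => ξ m ν t) (fun ν => ξ' m ν t)
      - q t * ∑ m, ∫ ν, κ ν * ξ m ν t = H := by
  have hth := hsol.isThermostat hκ hinit
  have hd : ∀ t, HasDerivAt (fun t => v t ^ 2 / 2 + U (q t) +
      ∑ m, thermostatEnergy (fun ν => ξ m ν t) (fun ν => ξ' m ν t)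
      - q t * ∑ m, ∫ ν, κ ν * ξ m ν t) 0 t := by
    intro t
    have hU' : HasDerivAt U (deriv U (q t)) (q t) :=
      (hU.differentiable (by norm_num)).differentiableAt.hasDerivAt
    have h1 := ((hsol.hasDerivAt_v t).pow 2).div_const 2
    have h2 := hU'.comp t (hsol.hasDerivAt_q t)
    have h3 := HasDerivAt.fun_sum (u := Finset.univ) fun m _ => (hth m).hasDerivAt_energy t
    have h4 := (hsol.hasDerivAt_q t).mul (HasDerivAt.fun_sum (u := Finset.univ) fun m _ =>
      (hth m).hasDerivAt_coupling (hsol.integrable m) t)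
    refine (((h1.add h2).add h3).sub h4).congr_deriv ?_
    simp only [Fin.sum_univ_two]
    push_cast; ring
  exact ⟨_, fun t => is_const_of_deriv_eq_zero (fun t => (hd t).differentiableAt)
    (fun t => (hd t).deriv) t 0⟩

/-- Completing the square in each thermostat absorbs the interaction energy and turns `U` into the
effective potential, so every term is bounded below. -/
lemma IsSolution.exists_shifted_energy_eq (hU : ContDiff ℝ ∞ U) (hκ : IsCoupling κ)
    (hsol : IsSolution U κ q v ξ ξ')
    (hinit : ∀ m, FiniteEnergy (fun ν => ξ m ν 0) (fun ν => ξ' m ν 0)) :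
    ∃ H, ∀ t, v t ^ 2 / 2 + effPotential U κ (q t) +
      ∑ m, (1 / 2) * ∫ ν, ‖shiftedAmp κ q (ξ m) (ξ' m) t ν‖ ^ 2 = H := by
  obtain ⟨H, hH⟩ := hsol.exists_energy_eq hU hκ hinit
  refine ⟨H, fun t => ?_⟩
  rw [← hH t, effPotential_apply]
  simp only [Fin.sum_univ_two]
  rw [(hsol.isThermostat hκ hinit 0).integral_norm_shiftedAmp_sq hκ.memLp_div,
    (hsol.isThermostat hκ hinit 1).integral_norm_shiftedAmp_sq hκ.memLp_div]
  ring

/-- A priori bounds along a solution. -/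
lemma IsSolution.exists_bound (hU : ContDiff ℝ ∞ U) (hκ : IsCoupling κ)
    (hV : Tendsto (effPotential U κ) (cocompact ℝ) atTop)
    (hsol : IsSolution U κ q v ξ ξ')
    (hinit : ∀ m, FiniteEnergy (fun ν => ξ m ν 0) (fun ν => ξ' m ν 0)) :
    ∃ B, ∀ t, |q t| ≤ B ∧ |v t| ≤ B ∧
      ∀ m, ∫ ν, ‖shiftedAmp κ q (ξ m) (ξ' m) t ν‖ ^ 2 ≤ B := by
  obtain ⟨H, hH⟩ := hsol.exists_shifted_energy_eq hU hκ hinit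
  obtain ⟨y₀, hy₀⟩ := (contDiff_effPotential κ hU).continuous.exists_forall_le hV
  set b := effPotential U κ y₀
  have hpos : ∀ m t, 0 ≤ ∫ ν, ‖shiftedAmp κ q (ξ m) (ξ' m) t ν‖ ^ 2 := fun m t =>
    integral_nonneg fun ν => by positivity
  have hVH : ∀ t, effPotential U κ (q t) ≤ H := fun t => by
    have := hH t
    simp only [Fin.sum_univ_two] at this
    linarith [hpos 0 t, hpos 1 t, sq_nonneg (v t)]
  obtain ⟨R, hR⟩ : ∃ R, ∀ y, R < |y| → H < effPotential U κ y := by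
    have := hV.eventually_gt_atTop H
    rw [← Metric.cobounded_eq_cocompact, ← comap_norm_atTop, eventually_comap] at this
    obtain ⟨R, hR⟩ := eventually_atTop.1 this
    exact ⟨R, fun y hy => hR _ hy.le y rfl⟩
  have hq : ∀ t, |q t| ≤ R := fun t => by
    by_contra hlt
    exact absurd (hVH t) (not_le.2 (hR _ (not_le.1 hlt)))
  -- The entry with `+ 1` bounds `|v|` through `|v| ≤ v² + 1`.
  refine ⟨max R (max (2 * (H - b)) (2 * (H - b) + 1)), fun t => ⟨?_, ?_, fun m => ?_⟩⟩
  · exact (hq t).trans (le_max_left _ _)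
  · refine le_trans ?_ ((le_max_right _ _).trans (le_max_right _ _))
    have := hH t
    simp only [Fin.sum_univ_two] at this
    have h2 : v t ^ 2 ≤ 2 * (H - b) := by linarith [hpos 0 t, hpos 1 t, hy₀ (q t)]
    rw [← sq_abs] at h2
    nlinarith [sq_nonneg (|v t| - 1)]
  · refine le_trans ?_ ((le_max_left _ _).trans (le_max_right _ _))
    have := hH t
    simp only [Fin.sum_univ_two] at this
    have h0 := hpos 0 t
    have h1 := hpos 1 t
    have h2 := hy₀ (q t)
    fin_cases m <;> simp only [Fin.zero_eta, Fin.mk_one] <;> linarith [sq_nonneg (v t)]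

/-- The two amplitudes differ by `iκq/ν`, whose `L²` norm is bounded because `q` is. -/
lemma exists_norm_amp_bound (hμ : MemLp (fun ν => κ ν / ν) 2) {x x' : ℝ → ℝ → ℝ}
    (h : IsThermostat κ q x x') {B : ℝ} (hq : ∀ t, |q t| ≤ B)
    (hs : ∀ t, ∫ ν, ‖shiftedAmp κ q x x' t ν‖ ^ 2 ≤ B) :
    ∃ C, ∀ t, ∫ ν, ‖amp x x' t ν‖ ^ 2 ≤ C := by
  refine ⟨2 * B + 2 * B ^ 2 * ∫ ν, (κ ν / ν) ^ 2, fun t => ?_⟩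
  have i1 := (h.memLp_shiftedAmp hμ t).norm.integrable_sq.const_mul 2
  have i2 := hμ.integrable_sq.const_mul (2 * B ^ 2)
  calc ∫ ν, ‖amp x x' t ν‖ ^ 2
      ≤ ∫ ν, (2 * ‖shiftedAmp κ q x x' t ν‖ ^ 2 + 2 * B ^ 2 * (κ ν / ν) ^ 2) := by
        refine integral_mono (h.memLp_amp t).norm.integrable_sq (i1.add i2) fun ν => ?_
        have e : amp x x' t ν = shiftedAmp κ q x x' t ν
            + Complex.I * ((κ ν / ν : ℝ) * q t) := by rw [shiftedAmp]; ring
        have hn : ‖Complex.I * ((κ ν / ν : ℝ) * q t)‖ = |κ ν / ν| * |q t| := by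
          rw [← Complex.ofReal_mul, norm_mul, Complex.norm_I, one_mul, Complex.norm_real,
            Real.norm_eq_abs, abs_mul]
        have h1 : ‖amp x x' t ν‖ ≤ ‖shiftedAmp κ q x x' t ν‖ + |κ ν / ν| * |q t| := by
          rw [e, ← hn]; exact norm_add_le _ _
        have h2 : |κ ν / ν| * |q t| ≤ |κ ν / ν| * B := by gcongr; exact hq t
        have h3 : ‖amp x x' t ν‖ ^ 2 ≤ (‖shiftedAmp κ q x x' t ν‖ + |κ ν / ν| * B) ^ 2 := by
          gcongr; linarith
        have h4 : (|κ ν / ν| * B) ^ 2 = B ^ 2 * (κ ν / ν) ^ 2 := by rw [mul_pow, sq_abs]; ring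
        show ‖amp x x' t ν‖ ^ 2 ≤ 2 * ‖shiftedAmp κ q x x' t ν‖ ^ 2 + 2 * B ^ 2 * (κ ν / ν) ^ 2
        nlinarith [sq_nonneg (‖shiftedAmp κ q x x' t ν‖ - |κ ν / ν| * B)]
    _ = 2 * (∫ ν, ‖shiftedAmp κ q x x' t ν‖ ^ 2) + 2 * B ^ 2 * ∫ ν, (κ ν / ν) ^ 2 := by
        rw [integral_add i1 i2, integral_const_mul, integral_const_mul]
    _ ≤ _ := by gcongr; exact hs t

/-- The force of a thermostat relative to the instantaneous equilibrium is bounded. -/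
lemma abs_im_integral_le (hμ : MemLp (fun ν => κ ν / ν) 2) {x x' : ℝ → ℝ → ℝ}
    (h : IsThermostat κ q x x') {B : ℝ} (hs : ∀ t, ∫ ν, ‖shiftedAmp κ q x x' t ν‖ ^ 2 ≤ B)
    (t : ℝ) : |(∫ ν, ((κ ν / ν : ℝ) : ℂ) * shiftedAmp κ q x x' t ν).im| ≤
      (∫ ν, (κ ν / ν) ^ 2) + B := by
  refine (Complex.abs_im_le_norm _).trans ((norm_integral_le_integral_norm _).trans ?_)
  have i1 := (h.memLp_shiftedAmp hμ t).norm.integrable_sq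
  have i2 := hμ.integrable_sq
  refine le_trans (b := ∫ ν, ((κ ν / ν) ^ 2 + ‖shiftedAmp κ q x x' t ν‖ ^ 2)) ?_ ?_
  · refine integral_mono (integrable_mul_of_memLp_two hμ.ofReal (h.memLp_shiftedAmp hμ t)).norm
      (i2.add i1) fun ν => ?_
    simp only [norm_mul, Complex.norm_real, Real.norm_eq_abs]
    rw [← sq_abs]
    nlinarith [sq_nonneg (|κ ν / ν| - ‖shiftedAmp κ q x x' t ν‖),
      mul_nonneg (abs_nonneg (κ ν / ν)) (norm_nonneg (shiftedAmp κ q x x' t ν))]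
  · rw [integral_add i2 i1]
    gcongr
    exact hs t

/-- The difference of the energies of two thermostats driven by the same force converges. -/
lemma exists_tendsto_energy_sub (hκ : Continuous κ) (h0 : ∀ ν, κ ν = 0 → ν = 0)
    {x x' y y' : ℝ → ℝ → ℝ} (hx : IsThermostat κ q x x') (hy : IsThermostat κ q y y')
    {B C D : ℝ} (hB : ∀ t, |q t| ≤ B) (hC : ∀ t, ∫ ν, ‖amp x x' t ν‖ ^ 2 ≤ C)
    (hD : ∀ t, ∫ ν, ‖amp y y' t ν‖ ^ 2 ≤ D) :
    ∃ c, Tendsto (fun t => thermostatEnergy (fun ν => x ν t) (fun ν => x' ν t) -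
      thermostatEnergy (fun ν => y ν t) (fun ν => y' ν t)) atTop (𝓝 c) := by
  obtain ⟨W, -, hW⟩ := hx.exists_weak_limit_amp hκ h0 hB hC
  obtain ⟨Z, -, hZ⟩ := hy.exists_weak_limit_amp hκ h0 hB hD
  -- With `F` the common forced term, `|a + F|² - |b + F|² = Re (conj (a - b) ((a + F) + (b + F)))`.
  -- The factor `a - b` is fixed in time, so weak convergence is enough.
  have hg : MemLp (fun ν => (starRingEnd ℂ) (amp x x' 0 ν - amp y y' 0 ν)) 2 :=
    (hx.memLp_amp_zero.sub hy.memLp_amp_zero).star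
  have hlim := (Complex.continuous_re.tendsto _).comp ((hW _ hg).add (hZ _ hg))
  refine ⟨_, (hlim.const_mul (1 / 2)).congr fun t => ?_⟩
  have ix : Integrable fun ν => (starRingEnd ℂ) (amp x x' 0 ν - amp y y' 0 ν) *
      (amp x x' 0 ν + κ ν * truncFourier q t ν) := integrable_mul_of_memLp_two hg
    (hx.memLp_amp_zero.add (hx.memLp_coupling_mul hx.continuous_force t))
  have iy : Integrable fun ν => (starRingEnd ℂ) (amp x x' 0 ν - amp y y' 0 ν) *
      (amp y y' 0 ν + κ ν * truncFourier q t ν) := integrable_mul_of_memLp_two hg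
    (hy.memLp_amp_zero.add (hy.memLp_coupling_mul hy.continuous_force t))
  rw [thermostatEnergy_eq, thermostatEnergy_eq, ← mul_sub,
    ← integral_sub (hx.memLp_amp t).norm.integrable_sq (hy.memLp_amp t).norm.integrable_sq]
  congr 1
  simp only [Function.comp]
  rw [← integral_add ix iy]
  refine (integral_re (ix.add iy)).symm.trans (integral_congr_ae ?_)
  filter_upwards [hx.amp_eq, hy.amp_eq] with ν h1 h2
  rw [h1 t, h2 t]
  simp only [norm_mul, norm_phase, one_mul, Pi.add_apply, ← Complex.normSq_eq_norm_sq,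
    Complex.normSq_apply]
  simp
  ring

/-- Convergence of the energies as `t → +∞`. -/
lemma IsSolution.exists_tendsto_atTop (hU : ContDiff ℝ ∞ U) (hκ : IsCoupling κ)
    (hV : Tendsto (effPotential U κ) (cocompact ℝ) atTop)
    (hcrit : HasIsolatedCriticalPoints (effPotential U κ))
    (hsol : IsSolution U κ q v ξ ξ')
    (hinit : ∀ m, FiniteEnergy (fun ν => ξ m ν 0) (fun ν => ξ' m ν 0)) (m : Fin 2) :
    ∃ E, Tendsto (fun t => thermostatEnergy (fun ν => ξ m ν t) (fun ν => ξ' m ν t)) atTop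
      (𝓝 E) := by
  have hth := hsol.isThermostat hκ hinit
  have hμ := hκ.memLp_div
  have hκc := hκ.contDiff.continuous
  have h0 : ∀ ν, κ ν = 0 → ν = 0 := fun ν => (hκ.eq_zero_iff ν).1
  have hqc : Continuous q := (hth 0).continuous_force
  have hvc : Continuous v := continuous_iff_continuousAt.2 fun t =>
    (hsol.hasDerivAt_v t).continuousAt
  obtain ⟨B, hB⟩ := hsol.exists_bound hU hκ hV hinit
  have hqB := fun t => (hB t).1
  have hvB := fun t => (hB t).2.1
  have hsB := fun m t => (hB t).2.2 m
  have hB0 : 0 ≤ B := (abs_nonneg _).trans (hqB 0)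
  choose C hC using fun m => exists_norm_amp_bound hμ (hth m) hqB (hsB m)
  set V := effPotential U κ with hVdef
  have hVsmooth : ContDiff ℝ ∞ V := contDiff_effPotential κ hU
  set r : ℝ → ℝ := fun t => ∑ m, (∫ ν, ((κ ν / ν : ℝ) : ℂ) *
    shiftedAmp κ q (ξ m) (ξ' m) t ν).im with hr
  -- Each thermostat contributes `K q` to the force; together these turn `-U'` into minus the
  -- derivative of the effective potential.
  have hforce : ∀ t, ∑ m, ∫ ν, κ ν * ξ m ν t = r t + 2 * couplingConst κ * q t := fun t => by
    simp only [hr, Fin.sum_univ_two]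
    rw [(hth 0).integral_coupling_eq hμ, (hth 1).integral_coupling_eq hμ]
    ring
  have hv' : ∀ t, HasDerivAt v (-deriv V (q t) + r t) t := fun t => by
    refine (hsol.hasDerivAt_v t).congr_deriv ?_
    rw [hforce, hVdef, deriv_effPotential κ hU]
    ring
  have hdV : ContDiff ℝ ∞ (deriv V) := (contDiff_infty_iff_deriv.1 hVsmooth).2
  have hddV : Continuous (deriv (deriv V)) := (contDiff_infty_iff_deriv.1 hdV).2.continuous
  obtain ⟨M₁, hM₁0, hM₁⟩ := exists_bound_of_abs_le hdV.continuous B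
  obtain ⟨M₂, hM₂0, hM₂⟩ := exists_bound_of_abs_le hddV B
  have hrB : ∀ t, |r t| ≤ 2 * ((∫ ν, (κ ν / ν) ^ 2) + B) := fun t => by
    simp only [hr, Fin.sum_univ_two]
    refine (abs_add_le _ _).trans ?_
    linarith [abs_im_integral_le hμ (hth 0) (hsB 0) t, abs_im_integral_le hμ (hth 1) (hsB 1) t]
  have hvlip : ∀ s t, |v s - v t| ≤ (M₁ + 2 * ((∫ ν, (κ ν / ν) ^ 2) + B)) * |s - t| :=
    abs_sub_le_of_hasDerivAt hv' fun t => by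
      refine (abs_add_le _ _).trans (add_le_add ?_ (hrB t))
      rw [abs_neg]; exact hM₁ _ (hqB t)
  have hqlip : ∀ s t, |q s - q t| ≤ B * |s - t| :=
    abs_sub_le_of_hasDerivAt hsol.hasDerivAt_q hvB
  -- One thermostat is enough to show that `q` is slowly varying.
  have hshift := tendsto_shift_sub hqc hqB hB0 hqlip fun φ hφ =>
    (hth 0).tendsto_convolution_zero hκc h0 hqB (hC 0) hφ
  have hv0 : Tendsto v atTop (𝓝 0) :=
    tendsto_zero_of_hasDerivAt (r := fun _ => 0)
      (add_nonneg hM₁0 ((abs_nonneg _).trans (hrB 0)))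
      (fun t => by simpa using hsol.hasDerivAt_q t) hshift tendsto_const_nhds hvlip
  have hr0 : Tendsto r atTop (𝓝 0) := by
    have := fun m => (Complex.continuous_im.tendsto 0).comp
      ((hth m).tendsto_integral_mul_shiftedAmp hκc h0 hμ hvc hsol.hasDerivAt_q hvB hv0 (hsB m)
        (g := fun ν => ((κ ν / ν : ℝ) : ℂ)) hμ.ofReal)
    have := tendsto_finsetSum Finset.univ fun m _ => this m
    simp only [Complex.zero_im, Finset.sum_const_zero] at this
    exact this
  have hg0 : Tendsto (fun t => -deriv V (q t)) atTop (𝓝 0) := by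
    refine tendsto_zero_of_hasDerivAt (f := v) (L := M₂ * B) (by positivity) hv' (fun a => ?_) hr0
      fun s t => ?_
    · simpa using (hv0.comp (tendsto_atTop_add_const_right _ a tendsto_id)).sub hv0
    · rw [neg_sub_neg, abs_sub_comm]
      refine abs_sub_le_of_hasDerivAt (f := fun t => deriv V (q t))
        (f' := fun t => deriv (deriv V) (q t) * v t) (fun t => ?_) (fun t => ?_) s t
      · exact ((hdV.differentiable (by norm_num)).differentiableAt.hasDerivAt).comp t
          (hsol.hasDerivAt_q t)
      · rw [abs_mul]
        exact mul_le_mul (hM₂ _ (hqB t)) (hvB t) (abs_nonneg _) hM₂0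
  obtain ⟨c, hc⟩ := exists_tendsto_of_isolated_zeros hqc hqB (g := deriv V)
    (by simpa using hg0.neg) hcrit
  obtain ⟨H, hH⟩ := hsol.exists_energy_eq hU hκ hinit
  -- In the conserved energy every term other than the thermostat energies now has a limit.
  have hsum : ∃ S, Tendsto (fun t => ∑ m, thermostatEnergy (fun ν => ξ m ν t)
      (fun ν => ξ' m ν t)) atTop (𝓝 S) := by
    have h1 := (hr0.add (hc.const_mul (2 * couplingConst κ)))
    have h2 := (((hv0.pow 2).div_const 2).add ((hU.continuous.tendsto c).comp hc)).sub (hc.mul h1)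
    refine ⟨_, (h2.const_sub H).congr fun t => ?_⟩
    rw [← hforce, ← hH t]
    simp only [Function.comp]
    ring
  obtain ⟨S, hS⟩ := hsum
  obtain ⟨d, hd⟩ := exists_tendsto_energy_sub hκc h0 (hth 0) (hth 1) hqB (hC 0) (hC 1)
  simp only [Fin.sum_univ_two] at hS
  fin_cases m
  · refine ⟨_, ((hS.add hd).div_const 2).congr fun t => ?_⟩
    simp only [Fin.zero_eta]; ring
  · refine ⟨_, ((hS.sub hd).div_const 2).congr fun t => ?_⟩
    simp only [Fin.mk_one]; ring

/-- Time reversal of solutions. -/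
lemma IsSolution.reverse (hsol : IsSolution U κ q v ξ ξ') :
    IsSolution U κ (fun t => q (-t)) (fun t => -v (-t)) (fun m ν t => ξ m ν (-t))
      (fun m ν t => -ξ' m ν (-t)) := by
  have key : ∀ {f : ℝ → ℝ} {f' t : ℝ}, HasDerivAt f f' (-t) →
      HasDerivAt (fun s => f (-s)) (-f') t := fun {f f' t} h => by
    exact (h.scomp t (hasDerivAt_neg t)).congr_deriv (by simp)
  refine ⟨fun m t => hsol.integrable m (-t), fun t => key (hsol.hasDerivAt_q (-t)), fun t => ?_,
    fun m => ?_, fun m => ?_⟩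
  · exact (key (hsol.hasDerivAt_v (-t))).neg.congr_deriv (by simp)
  · filter_upwards [hsol.hasDerivAt_ξ m] with ν hν t using key (hν (-t))
  · filter_upwards [hsol.hasDerivAt_ξ' m] with ν hν t
    refine (key (hν (-t))).neg.congr_deriv ?_
    ring

end

end TwoThermostats

theorem mainTheorem4 (U κ : ℝ → ℝ)
    (hU : ContDiff ℝ ∞ U)
    (hκ : TwoThermostats.IsCoupling κ)
    (hV : Tendsto (TwoThermostats.effPotential U κ) (cocompact ℝ) atTop)
    (hcrit : TwoThermostats.HasIsolatedCriticalPoints (TwoThermostats.effPotential U κ))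
    (q v : ℝ → ℝ) (ξ ξ' : Fin 2 → ℝ → ℝ → ℝ)
    (hsol : TwoThermostats.IsSolution U κ q v ξ ξ')
    (hinit : ∀ m : Fin 2,
      TwoThermostats.FiniteEnergy (fun ν => ξ m ν 0) (fun ν => ξ' m ν 0)) :
    ∀ m : Fin 2,
      (∀ t : ℝ, TwoThermostats.FiniteEnergy (fun ν => ξ m ν t) (fun ν => ξ' m ν t)) ∧
      (∃ Eplus : ℝ, Tendsto
        (fun t : ℝ => TwoThermostats.thermostatEnergy (fun ν => ξ m ν t) (fun ν => ξ' m ν t))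
        atTop (𝓝 Eplus)) ∧
      (∃ Eminus : ℝ, Tendsto
        (fun t : ℝ => TwoThermostats.thermostatEnergy (fun ν => ξ m ν t) (fun ν => ξ' m ν t))
        atBot (𝓝 Eminus)) := by
  intro m
  refine ⟨fun t => (hsol.isThermostat hκ hinit m).finiteEnergy t,
    hsol.exists_tendsto_atTop hU hκ hV hcrit hinit m, ?_⟩
  have hinit' : ∀ m : Fin 2, TwoThermostats.FiniteEnergy (fun ν => ξ m ν (-0))
      (fun ν => -ξ' m ν (-0)) := fun m => by
    simp only [neg_zero]
    exact ⟨(hinit m).1.neg, (hinit m).2⟩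
  obtain ⟨E, hE⟩ := hsol.reverse.exists_tendsto_atTop hU hκ hV hcrit hinit' m
  refine ⟨E, (hE.comp tendsto_neg_atBot_atTop).congr fun t => ?_⟩
  simp [TwoThermostats.thermostatEnergy]
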